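/- **Theorem 1.4.** For a permutation $\sigma=\sigma(1)\cdots\sigma(N)\in\mathfrak S_N$ put $\sigma(0)=\sigma(N+1)=0$. Let $\mathrm{val}\,\sigma$, $\mathrm{da}\,\sigma$, $\mathrm{dd}\,\sigma$ be the numbers of $i\in\{1,\dots,N\}$ with $\sigma(i-1)>\sigma(i)<\sigma(i+1)$, $\sigma(i-1)<\sigma(i)<\sigma(i+1)$, $\sigma(i-1)>\sigma(i)>\sigma(i+1)$ respectively, and let $\mathrm{des}\,\sigma$ be the number of $i\in\{1,\dots,N-1\}$ with $\sigma(i)>\sigma(i+1)$. Put $$(2\text{-}13)\,\sigma=\#\{(i,j):1\le i<j<N,\ \sigma(j)<\sigma(i)<\sigma(j+1)\},$$ $$(31\text{-}2)\,\sigma=\#\{(i,j):1<j<i\le N,\ \sigma(j)<\sigma(i)<\sigma(j-1)\}.$$ Let $\mathfrak S_N(3124,4123,3142,4132)$ be the set of permutations in $\mathfrak S_N$ avoiding the (classical) patterns $3124,4123,3142,4132$. Let $\mathcal B_n(p,q,t)$ be the Taylor coefficients of the formal continued fraction $$\sum_{n\ge0}\mathcal B_n(p,q,t)z^n=\cfrac{1}{1-(1+t)z-\cfrac{(p+q)tz^2}{1-p(1+t)z-\cfrac{p^3tz^2}{1-p^2(1+t)z-\cfrac{p^5tz^2}{\ddots}}}},$$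 let $$\mathcal B_n(p,q,t,u,v,w)=\sum_{\sigma\in\mathfrak S_{n+1}(3124,4123,3142,4132)}p^{(2\text{-}13)\,\sigma}q^{(31\text{-}2)\,\sigma}t^{\mathrm{des}\,\sigma}u^{\mathrm{da}\,\sigma}v^{\mathrm{dd}\,\sigma}w^{\mathrm{val}\,\sigma},$$ and let $$\gamma_{n+1,k}(p,q)=\sum_{\sigma}p^{(2\text{-}13)\,\sigma}q^{(31\text{-}2)\,\sigma},$$ where $\sigma$ runs over the permutations in $\mathfrak S_{n+1}(3124,4123,3142,4132)$ with $\mathrm{dd}\,\sigma=0$ and $\mathrm{val}\,\sigma=\mathrm{des}\,\sigma=k$. Then, for every $n\ge0$, the following hold. 1. $$\mathcal B_n(p,q,t)=\sum_{k=0}^{\lfloor n/2\rfloor}\gamma_{n+1,k}(p,q)\,t^k(1+t)^{n-2k}.$$ 2. $$\mathcal B_n(p,q,t,u,v,w)=\sum_{k=0}^{\lfloor n/2\rfloor}\gamma_{n+1,k}(p,q)\,(tw)^k(u+tv)^{n-2k}.$$ 3. For any elements $p,q\ge0$ of a nonzero linearly ordered commutative ring with strictly monotone multiplication by positive elements (for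 instance $\mathbb Z$ or $\mathbb R$), $\mathcal B_n(p,q,t)$ is $\gamma$-positive of center $n/2$ as a polynomial in $t$; that is, it is nonzero and of the form $\sum_{k=0}^{\lfloor n/2\rfloor}\gamma_kt^k(1+t)^{n-2k}$ with all $\gamma_k\ge0$. The identities in 1 and 2 hold for arbitrary elements $p,q,t,u,v,w$ of any commutative ring. -/

import Mathlib

namespace CatalanB

/-! ### Words and statistics of permutations -/

/-- The word `σ(1) σ(2) ⋯ σ(N)` of a permutation, as a function of a position `i : ℕ` counted
from `1`, with values in `{1, …, N}`, and with the convention `σ(0) = σ(N+1) = 0`. -/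
def word {N : ℕ} (σ : Equiv.Perm (Fin N)) (i : ℕ) : ℕ :=
  if h : 1 ≤ i ∧ i ≤ N then (σ ⟨i - 1, by omega⟩ : ℕ) + 1 else 0

/-- The number of valleys. -/
def val {N : ℕ} (σ : Equiv.Perm (Fin N)) : ℕ :=
  ((Finset.Icc 1 N).filter fun i =>
    word σ i < word σ (i - 1) ∧ word σ i < word σ (i + 1)).card

/-- The number of double ascents. -/
def da {N : ℕ} (σ : Equiv.Perm (Fin N)) : ℕ :=
  ((Finset.Icc 1 N).filter fun i =>
    word σ (i - 1) < word σ i ∧ word σ i < word σ (i + 1)).card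

/-- The number of double descents. -/
def dd {N : ℕ} (σ : Equiv.Perm (Fin N)) : ℕ :=
  ((Finset.Icc 1 N).filter fun i =>
    word σ i < word σ (i - 1) ∧ word σ (i + 1) < word σ i).card

/-- The number of descents: positions `1 ≤ i < N` with `σ(i) > σ(i+1)`. -/
def des {N : ℕ} (σ : Equiv.Perm (Fin N)) : ℕ :=
  ((Finset.Ico 1 N).filter fun i => word σ (i + 1) < word σ i).card

/-- The statistic `(2-13)`: the number of pairs `i < j < N` with `σ(j) < σ(i) < σ(j+1)`. -/
def stat2_13 {N : ℕ} (σ : Equiv.Perm (Fin N)) : ℕ :=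
  ∑ i ∈ Finset.Icc 1 N,
    ((Finset.Ioo i N).filter fun j => word σ j < word σ i ∧ word σ i < word σ (j + 1)).card

/-- The statistic `(31-2)`: the number of pairs `1 < j < i` with `σ(j) < σ(i) < σ(j-1)`. -/
def stat31_2 {N : ℕ} (σ : Equiv.Perm (Fin N)) : ℕ :=
  ∑ i ∈ Finset.Icc 1 N,
    ((Finset.Ioo 1 i).filter fun j => word σ j < word σ i ∧ word σ i < word σ (j - 1)).card

/-! ### Pattern avoidance -/

/-- `σ` avoids the pattern with one-line notation `τ`: no subsequence
`σ(f 0) σ(f 1) ⋯` is order-isomorphic to `τ`. -/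
def Avoids {N k : ℕ} (σ : Equiv.Perm (Fin N)) (τ : Fin k → ℕ) : Prop :=
  ¬ ∃ f : Fin k → Fin N, StrictMono f ∧ ∀ a b, σ (f a) < σ (f b) ↔ τ a < τ b

open Classical in
/-- The set of permutations of length `N` avoiding `3124`, `4123`, `3142` and `4132`. -/
noncomputable def avoiders (N : ℕ) : Finset (Equiv.Perm (Fin N)) :=
  Finset.univ.filter fun σ =>
    Avoids σ ![3, 1, 2, 4] ∧ Avoids σ ![4, 1, 2, 3] ∧
      Avoids σ ![3, 1, 4, 2] ∧ Avoids σ ![4, 1, 3, 2]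

/-! ### Jacobi-type continued fractions -/

section JFraction

/-- The `m`-th convergent of the tail of a J-fraction that starts at level `h`:
`1 / (1 - b h z - lam h z² / (1 - b (h+1) z - lam (h+1) z² / ⋯))` with `m` levels. The inverse
is the inverse of a formal power series with constant term `1`. -/
noncomputable def jConvergent {R : Type*} [CommRing R] (b lam : ℕ → R) :
    ℕ → ℕ → PowerSeries R
  | 0, _ => 0
  | m + 1, h =>
    PowerSeries.invOfUnit
      (1 - PowerSeries.C (b h) * PowerSeries.X
        - PowerSeries.C (lam h) * PowerSeries.X ^ 2 * jConvergent b lam m (h + 1)) 1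

/-- The infinite J-fraction
`1 / (1 - b 0 z - lam 0 z² / (1 - b 1 z - lam 1 z² / (1 - b 2 z - ⋯)))` as a formal power
series: the coefficientwise limit of its convergents. The coefficient of `zⁿ` is the same in all
convergents with more than `n` levels (see `coeff_jConvergent`). -/
noncomputable def jFraction {R : Type*} [CommRing R] (b lam : ℕ → R) : PowerSeries R :=
  PowerSeries.mk fun n => PowerSeries.coeff n (jConvergent b lam (n + 1) 0)

theorem jConvergent_succ_mul {R : Type*} [CommRing R] (b lam : ℕ → R) (m h : ℕ) :
    (1 - PowerSeries.C (b h) * PowerSeries.X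
        - PowerSeries.C (lam h) * PowerSeries.X ^ 2 * jConvergent b lam m (h + 1))
      * jConvergent b lam (m + 1) h = 1 := by
  rw [jConvergent]
  apply PowerSeries.mul_invOfUnit
  simp

theorem X_pow_dvd_jConvergent_sub {R : Type*} [CommRing R] (b lam : ℕ → R) (m h : ℕ) :
    (PowerSeries.X : PowerSeries R) ^ m ∣
      jConvergent b lam (m + 1) h - jConvergent b lam m h := by
  induction m generalizing h with
  | zero => simp
  | succ m ih =>
    obtain ⟨c, hc⟩ := ih (h + 1)
    have h1 := jConvergent_succ_mul b lam (m + 1) h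
    have h2 := jConvergent_succ_mul b lam m h
    refine ⟨PowerSeries.C (lam h) * PowerSeries.X * c * jConvergent b lam (m + 1) h
      * jConvergent b lam (m + 1 + 1) h, ?_⟩
    linear_combination (jConvergent b lam (m + 1) h) * h1
      - (jConvergent b lam (m + 1 + 1) h) * h2
      + PowerSeries.C (lam h) * PowerSeries.X ^ 2 * jConvergent b lam (m + 1) h
        * jConvergent b lam (m + 1 + 1) h * hc

theorem coeff_jConvergent {R : Type*} [CommRing R] (b lam : ℕ → R) {n m : ℕ} (hnm : n < m) :
    PowerSeries.coeff n (jConvergent b lam m 0) = PowerSeries.coeff n (jFraction b lam) := by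
  rw [jFraction, PowerSeries.coeff_mk]
  induction m, hnm using Nat.le_induction with
  | base => rfl
  | succ m hm ih =>
    rw [← ih, ← sub_eq_zero, ← map_sub]
    exact PowerSeries.X_pow_dvd_iff.1 (X_pow_dvd_jConvergent_sub b lam m 0) n hm

end JFraction

/-! ### The Catalan numbers of type B and the coefficients `γ` -/

/-- The `(p, q, t)`-Catalan number of type B: the coefficient of `zⁿ` in
`1 / (1 - (1+t) z - (p+q) t z² / (1 - p (1+t) z - p³ t z² / (1 - p² (1+t) z - p⁵ t z² / ⋯)))`. -/
noncomputable def catB {R : Type*} [CommRing R] (p q t : R) (n : ℕ) : R :=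
  PowerSeries.coeff n
    (jFraction (fun h => p ^ h * (1 + t))
      (fun h => if h = 0 then (p + q) * t else p ^ (2 * h + 1) * t))

/-- The six-variable refinement, a sum over the permutations of length `n + 1` that avoid
`3124`, `4123`, `3142` and `4132`. -/
noncomputable def catBRefined {R : Type*} [CommRing R] (p q t u v w : R) (n : ℕ) : R :=
  ∑ σ ∈ avoiders (n + 1),
    p ^ stat2_13 σ * q ^ stat31_2 σ * t ^ des σ * u ^ da σ * v ^ dd σ * w ^ val σ

/-- The coefficient `γ_{N,k}(p, q)`, a sum over the avoiders of length `N` without double descents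
that have exactly `k` valleys and exactly `k` descents. -/
noncomputable def gammaB {R : Type*} [CommRing R] (p q : R) (N k : ℕ) : R :=
  ∑ σ ∈ (avoiders N).filter (fun σ => dd σ = 0 ∧ val σ = k ∧ des σ = k),
    p ^ stat2_13 σ * q ^ stat31_2 σ

/-- A nonzero polynomial is `γ`-positive of center `n/2` if it is
`∑_{0 ≤ k ≤ n/2} γ_k t^k (1+t)^(n-2k)` with all `γ_k ≥ 0`. (Such a polynomial is palindromic of
center `n/2`, and the `γ_k` are unique.) -/
def IsGammaPositive {S : Type*} [CommRing S] [LinearOrder S] (n : ℕ) (f : Polynomial S) : Prop :=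
  f ≠ 0 ∧ ∃ γ : ℕ → S, (∀ k, 0 ≤ γ k) ∧
    f = ∑ k ∈ Finset.range (n / 2 + 1),
      Polynomial.C (γ k) * Polynomial.X ^ k * (1 + Polynomial.X) ^ (n - 2 * k)

end CatalanB

/-! In each of the four patterns, a letter `x` is followed by a smaller letter `y`, and then by two
letters above `y` of which at least one lies below `x`. Hence a permutation avoids all four exactly
when every occurrence `x y z` of 312 leaves `z` as the only letter above `y` to the right of `y`;
this is `Good`.

Cut a good word at its least letter, `X a Y`. If `X` or `Y` is empty, then `a` is a double ascent or
a double descent, because of the zeros at the two ends, and it can be removed. If both are nonempty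
and all letters of `X` lie below those of `Y`, then `X` avoids 312 and `Y` is good. Otherwise `Y` is
a single letter `c` and `X = X₁ M X₂`, where `M` consists of the letters above `c`; then `X₁ c X₂`
avoids 312 and `M` is good. The last two cases run over the same pairs of words. With a first word
of length `i + 1`, their extra factors are `w p^(i+1)` and `w q p^i` (`listWt_append_cons`,
`listWt_blocks`).

Setting `q = 0` selects the words that avoid 312. So the weighted sums `B_n(q)` over good words of
length `n + 1` satisfy `B_{n+1}(q) = (u+v) B_n(q) + w(p+q) ∑_{i<n} p^i B_i(0) B_{n-1-i}(q)`
(`goodSum_add_two`, `goodSeq_succ`). Both halves of the theorem follow from this recursion.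

For generating functions it says `F_q(z) (1 - (u+v) z - w(p+q) z² F_0(pz)) = 1`. Iterating the case
`q = 0` gives the continued fraction (`catB_eq_goodSeq`).

The recursion involves `u, v, w` only through `β = u + v` and `w`, and it is homogeneous when these
have degrees 1 and 2. So `B_n` is a combination of the `w^k β^(n-2k)` whose coefficients depend on
`p` and `q` alone (`goodSeq_eq_sum`). The choice `u = 1`, `v = 0` identifies them as sums over words
without double descents (`gammaB_eq_coeff`). Finally `des = val + dd` turns `v, w` into `tv, tw`. -/

namespace CatalanB

/-! ### Statistics of words -/

section ListStats

/-- The number of ascents `y z` of the word `l b` with `y < x < z`. -/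
def ups (x : ℕ) : List ℕ → ℕ → ℕ
  | [], _ => 0
  | y :: l, b => (if y < x ∧ x < l.headD b then 1 else 0) + ups x l b

/-- The number of descents `y z` of the word `a l` with `z < x < y`. -/
def downs (x : ℕ) : ℕ → List ℕ → ℕ
  | _, [] => 0
  | a, y :: l => (if y < x ∧ x < a then 1 else 0) + downs x y l

/-- The number of occurrences of `2-13` in the word `l b` whose letter `2` is in `l`. -/
def count213 : List ℕ → ℕ → ℕ
  | [], _ => 0
  | x :: l, b => ups x l b + count213 l b

/-- The number of occurrences of `31-2` in the word `a l`. -/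
def count312 : ℕ → List ℕ → ℕ
  | _, [] => 0
  | a, x :: l => l.countP (fun y => x < y ∧ y < a) + count312 x l

theorem headD_append (X Y : List ℕ) (b : ℕ) : (X ++ Y).headD b = X.headD (Y.headD b) := by
  cases X <;> simp

theorem ups_append (x : ℕ) (X Y : List ℕ) (b : ℕ) :
    ups x (X ++ Y) b = ups x X (Y.headD b) + ups x Y b := by
  induction X with
  | nil => simp [ups]
  | cons y X ih => simp only [List.cons_append, ups, headD_append, ih]; ring

theorem downs_append (x a : ℕ) (X Y : List ℕ) :
    downs x a (X ++ Y) = downs x a X + downs x (X.getLastD a) Y := by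
  induction X generalizing a with
  | nil => simp [downs]
  | cons y X ih => simp only [List.cons_append, downs, ih, List.getLastD_cons]; ring

/-- The middle term collects the occurrences with 2 in `X` and 13 in `Y`. The adjacent pair at the
junction belongs to the first term, through the boundary letter `Y.headD b`. -/
theorem count213_append (X Y : List ℕ) (b : ℕ) :
    count213 (X ++ Y) b
      = count213 X (Y.headD b) + (X.map fun x => ups x Y b).sum + count213 Y b := by
  induction X with
  | nil => simp [count213]
  | cons y X ih =>
    simp only [List.cons_append, count213, ups_append, ih, List.map_cons, List.sum_cons]; ring

theorem sum_map_downs_cons (Y : List ℕ) (a x : ℕ) (X : List ℕ) :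
    (Y.map fun y => downs y a (x :: X)).sum
      = Y.countP (fun y => x < y ∧ y < a) + (Y.map fun y => downs y x X).sum := by
  induction Y with
  | nil => simp
  | cons y Y ih =>
    simp only [downs] at ih
    simp only [List.map_cons, List.sum_cons, List.countP_cons, downs, decide_eq_true_eq, ih]; ring

/-- Here the junction belongs to the third term, through the boundary letter `X.getLastD a`; the
middle term has 31 in `a X` and 2 in `Y`. -/
theorem count312_append (a : ℕ) (X Y : List ℕ) :
    count312 a (X ++ Y)
      = count312 a X + (Y.map fun y => downs y a X).sum + count312 (X.getLastD a) Y := by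
  induction X generalizing a with
  | nil => simp [count312, downs]
  | cons x X ih =>
    simp only [List.cons_append, count312, ih, List.getLastD_cons, sum_map_downs_cons,
      List.countP_append]
    ring

theorem ups_eq_zero_of_le {x : ℕ} {l : List ℕ} (b : ℕ) (h : ∀ y ∈ l, x ≤ y) : ups x l b = 0 := by
  induction l with
  | nil => rfl
  | cons y l ih =>
    have := h y (by simp)
    simp [ups, ih fun z hz => h z (by simp [hz]), this]

theorem ups_eq_zero_of_ge {x : ℕ} {l : List ℕ} {b : ℕ} (hb : b ≤ x) (h : ∀ y ∈ l, y ≤ x) :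
    ups x l b = 0 := by
  induction l with
  | nil => rfl
  | cons y l ih =>
    have : l.headD b ≤ x := by
      cases l with
      | nil => simpa
      | cons z l => simpa using h z (by simp)
    rw [ups, ih fun z hz => h z (by simp [hz]), if_neg (by omega)]

theorem ups_congr {x b b' : ℕ} (l : List ℕ) (h : x < b ↔ x < b') : ups x l b = ups x l b' := by
  induction l with
  | nil => rfl
  | cons y l ih => cases l <;> simp_all [ups]

/-- A boundary letter matters only through comparisons with the letters of the word. This and its
analogues allow a factor of a word to be weighed as a word of its own, with 0 at its ends. -/
theorem count213_congr {b b' : ℕ} {l : List ℕ} (h : ∀ x ∈ l, (x < b ↔ x < b')) :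
    count213 l b = count213 l b' := by
  induction l with
  | nil => rfl
  | cons y l ih =>
    rw [count213, count213, ih fun x hx => h x (by simp [hx]), ups_congr l (h y (by simp))]

theorem downs_eq_zero_of_le {x a : ℕ} {l : List ℕ} (h : ∀ y ∈ l, x ≤ y) : downs x a l = 0 := by
  induction l generalizing a with
  | nil => rfl
  | cons y l ih =>
    have := h y (by simp)
    simp [downs, ih fun z hz => h z (by simp [hz]), this]

theorem downs_eq_zero_of_ge {x a : ℕ} {l : List ℕ} (ha : a ≤ x) (h : ∀ y ∈ l, y ≤ x) :
    downs x a l = 0 := by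
  induction l generalizing a with
  | nil => rfl
  | cons y l ih =>
    simp [downs, ih (h y (by simp)) fun z hz => h z (by simp [hz]), ha]

theorem count312_congr {a a' : ℕ} {l : List ℕ} (h : ∀ x ∈ l, (x < a ↔ x < a')) :
    count312 a l = count312 a' l := by
  cases l with
  | nil => rfl
  | cons y l =>
    simp only [count312, Nat.add_right_cancel_iff]
    refine List.countP_congr fun x hx => ?_
    simp [h x (by simp [hx])]

theorem getLastD_mem_cons (l : List ℕ) (a : ℕ) : l.getLastD a ∈ a :: l := by
  induction l generalizing a with
  | nil => simp
  | cons x l ih => rw [List.getLastD_cons]; exact List.mem_cons_of_mem _ (ih x)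

theorem headD_mem_cons (l : List ℕ) (b : ℕ) : l.headD b ∈ b :: l := by
  cases l <;> simp

variable {R : Type*} [CommRing R]

/-- The weight of a letter `x` between `a` and `b`: `w` for a valley, `u` for a double ascent, `v`
for a double descent, and `1` otherwise. -/
def localWt (u v w : R) (a x b : ℕ) : R :=
  (if x < a ∧ x < b then w else 1) * (if a < x ∧ x < b then u else 1)
    * (if x < a ∧ b < x then v else 1)

/-- The product of the local weights of the letters of `l` in the word `a l b`. -/
def chainWt (u v w : R) : ℕ → List ℕ → ℕ → R
  | _, [], _ => 1
  | a, x :: l, b => localWt u v w a x (l.headD b) * chainWt u v w x l b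

theorem chainWt_append (u v w : R) (a : ℕ) (X Y : List ℕ) (b : ℕ) :
    chainWt u v w a (X ++ Y) b
      = chainWt u v w a X (Y.headD b) * chainWt u v w (X.getLastD a) Y b := by
  induction X generalizing a with
  | nil => simp [chainWt]
  | cons y X ih =>
    simp only [List.cons_append, chainWt, ih, List.getLastD_cons, headD_append]; ring

theorem chainWt_congr_right (u v w : R) (a : ℕ) {l : List ℕ} {b b' : ℕ}
    (h : ∀ x ∈ l, (x < b ↔ x < b') ∧ (b < x ↔ b' < x)) :
    chainWt u v w a l b = chainWt u v w a l b' := by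
  induction l generalizing a with
  | nil => rfl
  | cons x l ih =>
    rw [chainWt, chainWt, ih x fun y hy => h y (by simp [hy])]
    cases l with
    | nil => simp [localWt, h x (by simp)]
    | cons y l => simp

theorem chainWt_congr_left (u v w : R) {a a' : ℕ} {l : List ℕ} (b : ℕ)
    (h : ∀ x ∈ l, (x < a ↔ x < a') ∧ (a < x ↔ a' < x)) :
    chainWt u v w a l b = chainWt u v w a' l b := by
  cases l with
  | nil => rfl
  | cons x l => simp [chainWt, localWt, h x (by simp)]

/-- The weight of a word. -/
def listWt (p q u v w : R) (l : List ℕ) : R :=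
  p ^ count213 l 0 * q ^ count312 0 l * chainWt u v w 0 l 0

end ListStats

/-! ### Avoidance for words -/

section ListAvoidance

/-- In the word `P X S`, no letter `y` of `X` plays the role of `1` in an occurrence of
`3124`, `4123`, `3142` or `4132`. -/
def Good (P : List ℕ) : List ℕ → List ℕ → Prop
  | [], _ => True
  | y :: X, S =>
    (∀ x ∈ P, ∀ z ∈ X ++ S, ∀ w ∈ X ++ S, y < z → z < x → y < w → w = z) ∧ Good (P ++ [y]) X S

/-- In the word `P X S`, no letter `y` of `X` plays the role of `1` in an occurrence of `312`. -/
def Avoid312 (P : List ℕ) : List ℕ → List ℕ → Prop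
  | [], _ => True
  | y :: X, S => (∀ x ∈ P, ∀ z ∈ X ++ S, y < z → ¬ z < x) ∧ Avoid312 (P ++ [y]) X S

theorem good_iff {P X S : List ℕ} :
    Good P X S ↔ ∀ X₁ y X₂, X = X₁ ++ y :: X₂ → ∀ x ∈ P ++ X₁, ∀ z ∈ X₂ ++ S, ∀ w ∈ X₂ ++ S,
      y < z → z < x → y < w → w = z := by
  induction X generalizing P with
  | nil => simp [Good]
  | cons a X ih =>
    rw [Good, ih]
    constructor
    · rintro ⟨h₁, h₂⟩ X₁ y X₂ h
      cases X₁ with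
      | nil =>
        obtain ⟨rfl, rfl⟩ := by simpa using h
        simpa using h₁
      | cons b X₁ =>
        obtain ⟨rfl, rfl⟩ := by simpa using h
        simpa using h₂ X₁ y X₂ rfl
    · intro h
      refine ⟨by simpa using h [] a X rfl, ?_⟩
      rintro X₁ y X₂ rfl
      simpa using h (a :: X₁) y X₂ rfl

theorem avoid312_iff {P X S : List ℕ} :
    Avoid312 P X S ↔ ∀ X₁ y X₂, X = X₁ ++ y :: X₂ → ∀ x ∈ P ++ X₁, ∀ z ∈ X₂ ++ S,
      y < z → ¬ z < x := by
  induction X generalizing P with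
  | nil => simp [Avoid312]
  | cons a X ih =>
    rw [Avoid312, ih]
    constructor
    · rintro ⟨h₁, h₂⟩ X₁ y X₂ h
      cases X₁ with
      | nil =>
        obtain ⟨rfl, rfl⟩ := by simpa using h
        simpa using h₁
      | cons b X₁ =>
        obtain ⟨rfl, rfl⟩ := by simpa using h
        simpa using h₂ X₁ y X₂ rfl
    · intro h
      refine ⟨by simpa using h [] a X rfl, ?_⟩
      rintro X₁ y X₂ rfl
      simpa using h (a :: X₁) y X₂ rfl

theorem good_append {P X Y S : List ℕ} :
    Good P (X ++ Y) S ↔ Good P X (Y ++ S) ∧ Good (P ++ X) Y S := by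
  induction X generalizing P with
  | nil => simp [Good]
  | cons y X ih => simp [Good, ih, and_assoc]

theorem avoid312_append {P X Y S : List ℕ} :
    Avoid312 P (X ++ Y) S ↔ Avoid312 P X (Y ++ S) ∧ Avoid312 (P ++ X) Y S := by
  induction X generalizing P with
  | nil => simp [Avoid312]
  | cons y X ih => simp [Avoid312, ih, and_assoc]

/-- Smaller letters in front and behind do not matter. -/
theorem good_iff_of_lt {P X S : List ℕ} (hP : ∀ x ∈ P, ∀ y ∈ X, x < y)
    (hS : ∀ x ∈ S, ∀ y ∈ X, x < y) : Good P X S ↔ Good [] X [] := by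
  simp only [good_iff]
  refine forall_congr' fun X₁ => forall_congr' fun y => forall_congr' fun X₂ =>
    forall_congr' fun h => ?_
  subst h
  constructor
  · intro h x hx z hz w hw
    simp only [List.append_nil, List.nil_append] at hx hz hw
    exact h x (by simp [hx]) z (by simp [hz]) w (by simp [hw])
  · intro h x hx z hz w hw hyz hzx hyw
    rw [List.mem_append] at hx hz hw
    have hz' : z ∈ X₂ := hz.resolve_right fun hz => by have := hS z hz y (by simp); omega
    have hw' : w ∈ X₂ := hw.resolve_right fun hw => by have := hS w hw y (by simp); omega
    have hx' : x ∈ X₁ := hx.resolve_left fun hx => by have := hP x hx y (by simp); omega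
    exact h x (by simpa) z (by simpa) w (by simpa) hyz hzx hyw

theorem good_of_avoid312 {P X S : List ℕ} (h : Avoid312 P X S) : Good P X S := by
  rw [avoid312_iff] at h
  rw [good_iff]
  intro X₁ y X₂ hX x hx z hz w _ hyz hzx
  exact absurd hzx (h X₁ y X₂ hX x hx z hz hyz)

theorem count312_eq_zero_of_avoid312 {P X : List ℕ} {a : ℕ} (ha : a = 0 ∨ a ∈ P)
    (h : Avoid312 P X []) : count312 a X = 0 := by
  induction X generalizing P a with
  | nil => rfl
  | cons x X ih =>
    rw [count312, ih (Or.inr (by simp)) h.2, Nat.add_zero, List.countP_eq_zero]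
    intro y hy
    have := h.1
    simp only [List.append_nil] at this
    rcases ha with rfl | ha
    · simp
    · simpa using this a ha y hy

/-- A discrete intermediate value argument: a word that starts above `z`, misses `z` and has no
descent across it stays above `z`. -/
theorem lt_of_downs_eq_zero {z a : ℕ} {l : List ℕ} (h : downs z a l = 0) (ha : z < a)
    (hl : z ∉ l) : ∀ y ∈ l, z < y := by
  induction l generalizing a with
  | nil => simp
  | cons x l ih =>
    simp only [downs, Nat.add_eq_zero_iff, ite_eq_right_iff] at h
    simp only [List.mem_cons, not_or] at hl
    have hx : z < x := by
      by_contra hx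
      exact absurd (h.1 ⟨by omega, ha⟩) one_ne_zero
    simpa [hx] using ih h.2 hx hl.2

/-- An occurrence `x y z` of 312 forces an adjacent descent across `z` on the way from `x` down to
`y`, hence an occurrence of 31-2. -/
theorem avoid312_iff_count312 {X : List ℕ} (hX : X.Nodup) :
    Avoid312 [] X [] ↔ count312 0 X = 0 := by
  refine ⟨count312_eq_zero_of_avoid312 (Or.inl rfl), fun h => ?_⟩
  rw [avoid312_iff]
  rintro X₁ y X₂ rfl x hx z hz hyz hzx
  simp only [List.append_nil, List.nil_append] at hx hz
  obtain ⟨U, V, rfl⟩ := List.append_of_mem hx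
  rw [show U ++ x :: V ++ y :: X₂ = U ++ [x] ++ (V ++ [y]) ++ X₂ by simp] at h hX
  rw [count312_append] at h
  have h₁ : (X₂.map fun y_1 => downs y_1 0 (U ++ [x] ++ (V ++ [y]))).sum = 0 := by omega
  rw [List.sum_eq_zero_iff] at h₁
  have h₂ := h₁ _ (List.mem_map_of_mem hz)
  rw [downs_append, Nat.add_eq_zero_iff] at h₂
  have h₃ := lt_of_downs_eq_zero (z := z) (by simpa using h₂.2) (by simpa using hzx)
    (fun hz' => (List.disjoint_of_nodup_append hX) (by simp at hz' ⊢; tauto) hz) y (by simp)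
  omega

/-- A good word in which `a` is the least letter, all the letters before `a` being smaller than all
those after it. -/
theorem good_append_cons_iff {X Y : List ℕ} {a : ℕ} (hX : ∀ x ∈ X, a < x) (hY : ∀ y ∈ Y, a < y)
    (hXY : ∀ x ∈ X, ∀ y ∈ Y, x < y) (h0 : Y ≠ []) :
    Good [] (X ++ a :: Y) [] ↔ Avoid312 [] X [] ∧ Good [] Y [] := by
  rw [good_append, Good, List.nil_append, good_iff_of_lt (P := X ++ [a]) (X := Y)]
  rotate_left
  · intro x hx y hy
    rcases List.mem_append.1 hx with hx | hx
    · exact hXY x hx y hy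
    · rw [List.mem_singleton.1 hx]; exact hY y hy
  · simp
  rw [← and_assoc]
  refine and_congr_left fun _ => ⟨fun h => ?_, fun h => ⟨?_, ?_⟩⟩
  · rw [avoid312_iff]
    rintro X₁ y X₂ rfl x hx z hz hyz hzx
    -- A 312 inside `X` is completed to a forbidden pattern by any letter of `Y`, which lies above
    -- all of `X`.
    obtain ⟨w, hw⟩ := List.exists_mem_of_ne_nil Y h0
    simp only [List.append_nil] at hz
    have := good_iff.1 h.1 X₁ y X₂ rfl x hx z (by simp [hz]) w (by simp [hw]) hyz hzx
      (hXY y (by simp) w hw)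
    have := hXY z (by simp [hz]) w hw
    omega
  · rw [avoid312_iff] at h
    rw [good_iff]
    rintro X₁ y X₂ rfl x hx z hz w hw hyz hzx hyw
    simp only [List.append_nil, List.nil_append, List.mem_append, List.mem_cons] at hz hx
    rcases hz with hz | rfl | hz
    · exact absurd hzx (h X₁ y X₂ rfl x (by simpa using hx) z (by simpa using hz) hyz)
    · have := hX y (by simp); omega
    · have := hXY x (by simp [hx]) z hz; omega
  · intro x hx z hz w hw haz hzx
    have := hXY x hx z (by simpa using hz)
    omega

/-- A good word in which the least letter `a` is followed by one letter `c` only, such that the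
letters larger than `c` are contiguous. -/
theorem good_blocks_iff {X₁ M X₂ : List ℕ} {a c : ℕ} (hX₁ : ∀ x ∈ X₁, a < x ∧ x < c)
    (hX₂ : ∀ x ∈ X₂, a < x ∧ x < c) (hM : ∀ x ∈ M, c < x) (h0 : M ≠ []) (hac : a < c) :
    Good [] (X₁ ++ (M ++ (X₂ ++ [a, c]))) [] ↔
      Avoid312 [] (X₁ ++ c :: X₂) [] ∧ Good [] M [] := by
  obtain ⟨m, hm⟩ := List.exists_mem_of_ne_nil M h0
  have hcm := hM m hm
  rw [good_append, good_append, good_append, Good, Good, Good, List.nil_append,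
    good_iff_of_lt (P := X₁) (X := M)]
  rotate_left
  · intro x hx y hy
    have := hX₁ x hx; have := hM y hy; omega
  · intro x hx y hy
    have := hM y hy
    simp only [List.append_nil, List.mem_append, List.mem_cons, List.not_mem_nil, or_false] at hx
    rcases hx with hx | rfl | rfl
    · have := hX₂ x hx; omega
    · omega
    · omega
  rw [avoid312_append, Avoid312, List.nil_append]
  constructor
  -- A 312 inside `X₁` is completed by a letter `m` of `M`. An ascending pair in `X₂` is preceded by
  -- `m`, in the role of the largest letter so far, and followed by the final `c`.
  · rintro ⟨h₁, hG, h₂, -⟩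
    refine ⟨⟨?_, by intro x hx z _ _; have := hX₁ x hx; omega, ?_⟩, hG⟩
    · rw [avoid312_iff]
      rintro Y₁ y Y₂ rfl x hx z hz hyz hzx
      simp only [List.nil_append] at hx
      have hzc : z < c := by have := hX₁ x (by simp [hx]); omega
      have hzm : z ∈ Y₂ ∨ z ∈ X₂ := by
        simp only [List.append_nil, List.mem_append, List.mem_cons] at hz
        rcases hz with hz | rfl | hz
        · exact Or.inl hz
        · omega
        · exact Or.inr hz
      have := good_iff.1 h₁ Y₁ y Y₂ rfl x (by simpa using hx) z
        (by simp only [List.mem_append]; tauto) m (by simp [hm]) hyz hzx (by omega)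
      omega
    · rw [avoid312_iff]
      rintro Y₁ y Y₂ rfl x hx z hz hyz hzx
      simp only [List.append_nil] at hz
      have hzc := hX₂ z (by simp [hz])
      have hyc := hX₂ y (by simp)
      have := good_iff.1 h₂ Y₁ y Y₂ rfl m (by simp [hm]) z (by simp [hz]) c (by simp) hyz
        (by omega) hyc.2
      omega
  · rintro ⟨⟨h₁, -, h₂⟩, hG⟩
    refine ⟨?_, hG, ?_, ?_, by simp, trivial⟩
    · rw [good_iff]
      rintro Y₁ y Y₂ rfl x hx z hz w hw hyz hzx hyw
      have hxc := hX₁ x (by simp only [List.nil_append] at hx; simp [hx])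
      have hya := hX₁ y (by simp)
      have hz' : z ∈ Y₂ ∨ z ∈ X₂ := by
        simp only [List.append_nil, List.mem_append, List.mem_cons, List.not_mem_nil,
          or_false] at hz
        rcases hz with hz | hz | hz | rfl | rfl
        · exact Or.inl hz
        · have := hM z hz; omega
        · exact Or.inr hz
        · omega
        · omega
      exact absurd hzx (avoid312_iff.1 h₁ Y₁ y Y₂ rfl x hx z
        (by simp only [List.append_nil, List.mem_append, List.mem_cons]; tauto) hyz)
    · rw [good_iff]
      rintro Y₁ y Y₂ rfl x hx z hz w hw hyz hzx hyw
      have hya := hX₂ y (by simp)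
      rw [avoid312_iff] at h₂
      -- Since `c` precedes `X₂` in the word avoiding 312 and exceeds all its letters, `X₂` is
      -- decreasing. So the final `c` is the only letter above `y` that comes after it.
      have key : ∀ s ∈ Y₂, ¬ y < s := fun s hs hys => by
        have := h₂ Y₁ y Y₂ rfl c (by simp) s (by simpa using hs) hys
        have := hX₂ s (by simp [hs])
        omega
      have key' : ∀ s ∈ Y₂ ++ ([a, c] ++ []), y < s → s = c := fun s hs hys => by
        simp only [List.append_nil, List.mem_append, List.mem_cons, List.not_mem_nil,
          or_false] at hs
        rcases hs with hs | rfl | rfl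
        · exact absurd hys (key s hs)
        · omega
        · rfl
      rw [key' z hz hyz, key' w hw hyw]
    · intro x hx z hz w hw _ _ _
      simp only [List.append_nil, List.mem_singleton] at hz hw
      rw [hz, hw]

/-- The shape of a good word with least letter `a` that is not covered by
`good_append_cons_iff`. -/
theorem exists_blocks_of_good {X Y : List ℕ} {a : ℕ} (hn : (X ++ a :: Y).Nodup)
    (hX : ∀ x ∈ X, a < x) (hY : ∀ y ∈ Y, a < y) (hXY : ¬ ∀ x ∈ X, ∀ y ∈ Y, x < y)
    (h : Good [] (X ++ a :: Y) []) :
    ∃ c X₁ M X₂, Y = [c] ∧ X = X₁ ++ (M ++ X₂) ∧ M ≠ [] ∧ (∀ x ∈ M, c < x) ∧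
      (∀ x ∈ X₁, x < c) ∧ ∀ x ∈ X₂, x < c := by
  push Not at hXY
  obtain ⟨x, hx, c, hc, hcx⟩ := hXY
  have hne : ∀ s ∈ X, s ≠ c := by
    rintro s hs rfl
    exact List.disjoint_of_nodup_append hn hs (by simp [hc])
  have hcx' : c < x := lt_of_le_of_ne hcx (hne x hx).symm
  rw [good_append, Good] at h
  -- As `x a c` is a 312 and every letter of `Y` exceeds `a`, goodness leaves only `c` after `a`.
  have hYc : ∀ w ∈ Y, w = c := fun w hw =>
    h.2.1 x (by simpa) c (by simpa) w (by simpa) (hY c hc) hcx' (hY w hw)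
  have hYn : Y.Nodup := (List.nodup_cons.1 (List.Nodup.of_append_right hn)).2
  obtain rfl : Y = [c] := by
    match Y, hYc, hc, hYn with
    | [y], hYc, _, _ => rw [hYc y (by simp)]
    | y :: z :: Y, hYc, _, hYn =>
      exfalso
      rw [hYc y (by simp), hYc z (by simp)] at hYn
      simp at hYn
  obtain ⟨X₁, R, rfl, hX₁, hR⟩ : ∃ X₁ R, X = X₁ ++ R ∧ (∀ x ∈ X₁, x < c) ∧
      ∀ r ∈ R.head?, c ≤ r :=
    ⟨X.takeWhile (· < c), X.dropWhile (· < c), (List.takeWhile_append_dropWhile).symm,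
      fun x hx => by simpa using List.mem_takeWhile_imp hx,
      fun r hr => by
        have := List.head?_dropWhile_not (fun s => decide (s < c)) X
        rw [Option.mem_def.1 hr] at this
        simpa using this⟩
  obtain ⟨M, X₂, rfl, hM, hX₂⟩ : ∃ M X₂, R = M ++ X₂ ∧ (∀ x ∈ M, c < x) ∧
      ∀ r ∈ X₂.head?, r ≤ c :=
    ⟨R.takeWhile (c < ·), R.dropWhile (c < ·), (List.takeWhile_append_dropWhile).symm,
      fun x hx => by simpa using List.mem_takeWhile_imp hx,
      fun r hr => by
        have := List.head?_dropWhile_not (fun s => decide (c < s)) R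
        rw [Option.mem_def.1 hr] at this
        simpa using this⟩
  have hM0 : M ≠ [] := by
    rintro rfl
    cases X₂ with
    | nil =>
      have := hX₁ x (by simpa using hx)
      omega
    | cons r X₂ =>
      have h₁ := hR r (by simp)
      have h₂ := hX₂ r (by simp)
      exact hne r (by simp) (by omega)
  refine ⟨c, X₁, M, X₂, rfl, rfl, hM0, hM, hX₁, ?_⟩
  obtain ⟨m, hm⟩ := List.exists_mem_of_ne_nil M hM0
  have hcm := hM m hm
  cases X₂ with
  | nil => simp
  | cons y X₂ =>
    have hyc : y < c := lt_of_le_of_ne (hX₂ y (by simp)) (hne y (by simp))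
    intro s hs
    rcases List.mem_cons.1 hs with rfl | hs
    · exact hyc
    · by_contra hsc
      have hsc' := hne s (by simp [hs])
      -- If the word rose above `c` again at `s`, then `m y c` would be a 312 with the second letter
      -- `s` above `y`.
      have := good_iff.1 h.1 (X₁ ++ M) y X₂ (by simp) m (by simp [hm]) c (by simp) s
        (by simp [hs]) hyc hcm (by omega)
      omega

theorem good_cons_iff {X : List ℕ} {a : ℕ} (hX : ∀ x ∈ X, a < x) :
    Good [] (a :: X) [] ↔ Good [] X [] := by
  rw [Good, good_iff_of_lt (by simpa using hX) (by simp)]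
  simp

theorem good_concat_iff {X : List ℕ} {a : ℕ} (hX : ∀ x ∈ X, a < x) :
    Good [] (X ++ [a]) [] ↔ Good [] X [] := by
  rw [good_append, good_iff_of_lt (by simp) (by simpa using hX)]
  simp [Good]

end ListAvoidance

/-! ### The weight of a decomposed word -/

section Weights

variable {R : Type*} [CommRing R]

theorem getLastD_mem {X : List ℕ} (h : X ≠ []) (a : ℕ) : X.getLastD a ∈ X := by
  cases X with
  | nil => exact absurd rfl h
  | cons x X => rw [List.getLastD_cons]; exact getLastD_mem_cons X x

theorem headD_mem {X : List ℕ} (h : X ≠ []) (b : ℕ) : X.headD b ∈ X := by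
  cases X with
  | nil => exact absurd rfl h
  | cons x X => simp

theorem sum_map_eq_zero {X : List ℕ} {f : ℕ → ℕ} (h : ∀ x ∈ X, f x = 0) : (X.map f).sum = 0 := by
  rw [List.sum_eq_zero_iff]
  simpa using h

theorem sum_map_eq_length {X : List ℕ} {f : ℕ → ℕ} (h : ∀ x ∈ X, f x = 1) :
    (X.map f).sum = X.length := by
  rw [List.map_congr_left h]
  simp

theorem ups_cons_of_lt {x y b : ℕ} {Y : List ℕ} (hy : y < x) (h0 : Y ≠ []) (hY : ∀ z ∈ Y, x < z) :
    ups x (y :: Y) b = 1 := by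
  rw [ups, if_pos ⟨hy, hY _ (headD_mem h0 b)⟩, ups_eq_zero_of_le _ fun z hz => (hY z hz).le]

theorem downs_of_lt {x a : ℕ} {X : List ℕ} (ha : x < a) (h0 : X ≠ []) (hX : ∀ z ∈ X, z < x) :
    downs x a X = 1 := by
  cases X with
  | nil => exact absurd rfl h0
  | cons y X =>
    rw [downs, if_pos ⟨hX y (by simp), ha⟩, downs_eq_zero_of_ge (hX y (by simp)).le
      fun z hz => (hX z (by simp [hz])).le]

theorem localWt_valley (u v w : R) {a x b : ℕ} (ha : x < a) (hb : x < b) :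
    localWt u v w a x b = w := by
  simp [localWt, ha, hb, ha.not_gt, hb.not_gt]

theorem localWt_ascent (u v w : R) {a x b : ℕ} (ha : a < x) (hb : x < b) :
    localWt u v w a x b = u := by
  simp [localWt, ha, hb, ha.not_gt, hb.not_gt]

theorem localWt_descent (u v w : R) {a x b : ℕ} (ha : x < a) (hb : b < x) :
    localWt u v w a x b = v := by
  simp [localWt, ha, hb, ha.not_gt, hb.not_gt]

theorem localWt_peak (u v w : R) {a x b : ℕ} (ha : a < x) (hb : b < x) :
    localWt u v w a x b = 1 := by
  simp [localWt, ha, hb, ha.not_gt, hb.not_gt]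

theorem listWt_cons (p q u v w : R) {a : ℕ} {Y : List ℕ} (ha : 0 < a) (hY : ∀ y ∈ Y, a < y)
    (h0 : Y ≠ []) : listWt p q u v w (a :: Y) = u * listWt p q u v w Y := by
  rw [listWt, listWt, count213, count312, chainWt, localWt_ascent _ _ _ ha (hY _ (headD_mem h0 0)),
    ups_eq_zero_of_le 0 fun y hy => (hY y hy).le,
    count312_congr (a' := 0) (l := Y) fun y hy => by have := hY y hy; omega,
    chainWt_congr_left u v w (a' := 0) (l := Y) 0 fun y hy => by have := hY y hy; omega,
    List.countP_eq_zero.2 (by simp)]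
  simp only [Nat.zero_add]
  ring

theorem listWt_concat (p q u v w : R) {a : ℕ} {X : List ℕ} (ha : 0 < a) (hX : ∀ x ∈ X, a < x)
    (h0 : X ≠ []) : listWt p q u v w (X ++ [a]) = v * listWt p q u v w X := by
  rw [listWt, listWt, count213_append, count312_append, chainWt_append,
    count213_congr (b' := 0) (l := X) fun x hx => by
      have := hX x hx; simp only [List.headD_cons]; omega,
    chainWt_congr_right u v w 0 (b' := 0) (l := X) fun x hx => by
      have := hX x hx; simp only [List.headD_cons]; omega,
    sum_map_eq_zero fun x hx => ups_eq_zero_of_ge (Nat.zero_le _) fun y hy => by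
      rw [List.mem_singleton.1 hy]; exact (hX x hx).le,
    sum_map_eq_zero (X := [a]) fun y hy => downs_eq_zero_of_le fun x hx => by
      rw [List.mem_singleton.1 hy]; exact (hX x hx).le,
    chainWt, localWt_descent _ _ _ (hX _ (getLastD_mem h0 0)) (by simpa)]
  simp only [count213, count312, chainWt, ups, List.countP_nil]
  simp
  ring

/-- The letter `a` is a valley, and the ascent that leaves it is the 13 of one new 2-13 for each
letter of `X`. No 31-2 uses letters from both sides of the cut, and `q` may be replaced by 0 in the
weight of `X` because `X` has no 31-2. -/
theorem listWt_append_cons (p q u v w : R) {a : ℕ} {X Y : List ℕ} (ha : 0 < a)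
    (hX : ∀ x ∈ X, a < x) (hY : ∀ y ∈ Y, a < y) (hX0 : X ≠ []) (hY0 : Y ≠ [])
    (hXY : ∀ x ∈ X, ∀ y ∈ Y, x < y) (hC : count312 0 X = 0) :
    listWt p q u v w (X ++ a :: Y)
      = w * p ^ X.length * (listWt p 0 u v w X * listWt p q u v w Y) := by
  rw [listWt, listWt, listWt, count213_append, count312_append, chainWt_append,
    count213_congr (b' := 0) (l := X) fun x hx => by
      have := hX x hx; simp only [List.headD_cons]; omega,
    chainWt_congr_right u v w 0 (b' := 0) (l := X) fun x hx => by
      have := hX x hx; simp only [List.headD_cons]; omega,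
    sum_map_eq_length fun x hx => ups_cons_of_lt (hX x hx) hY0 (hXY x hx),
    sum_map_eq_zero (X := a :: Y) fun y hy => ?_,
    chainWt, localWt_valley _ _ _ (hX _ (getLastD_mem hX0 0)) (hY _ (headD_mem hY0 0)),
    hC, count213, ups_eq_zero_of_le 0 fun y hy => (hY y hy).le, count312,
    List.countP_eq_zero.2,
    count312_congr (a' := 0) (l := Y) fun y hy => by have := hY y hy; omega,
    chainWt_congr_left u v w (a' := 0) (l := Y) 0 fun y hy => by have := hY y hy; omega]
  · simp only [Nat.zero_add, Nat.add_zero, pow_add, pow_zero]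
    ring
  · intro y hy
    have := hXY _ (getLastD_mem hX0 0) y hy
    simp only [decide_eq_true_eq]
    omega
  · rcases List.mem_cons.1 hy with rfl | hy
    · exact downs_eq_zero_of_le fun x hx => (hX x hx).le
    · exact downs_eq_zero_of_ge (Nat.zero_le _) fun x hx => (hXY x hx y hy).le

/-- The final ascent `a c` gives one new 2-13 for each letter of `X₁` and `X₂`. The descent that
leaves `M` crosses `c`, which gives exactly one new 31-2, with the final `c` as its 2. Seen from
`X₁` and `X₂`, the block `M` acts like the letter `c`, and `a` is the one new valley. -/
theorem listWt_blocks (p q u v w : R) {X₁ M X₂ : List ℕ} {a c : ℕ} (ha : 0 < a)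
    (hX₁ : ∀ x ∈ X₁, a < x ∧ x < c) (hX₂ : ∀ x ∈ X₂, a < x ∧ x < c) (hM : ∀ x ∈ M, c < x)
    (h0 : M ≠ []) (hac : a < c) (hC : count312 0 (X₁ ++ c :: X₂) = 0) :
    listWt p q u v w (X₁ ++ (M ++ (X₂ ++ [a, c])))
      = w * (q * p ^ (X₁.length + X₂.length))
        * (listWt p 0 u v w (X₁ ++ c :: X₂) * listWt p q u v w M) := by
  have hhd : c < (M ++ (X₂ ++ [a, c])).headD 0 := by
    rw [headD_append]; exact hM _ (headD_mem h0 _)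
  have hlast : c < M.getLastD (X₁.getLastD 0) := hM _ (getLastD_mem h0 _)
  set m := M.getLastD (X₁.getLastD 0) with hm
  have hl₁ : X₁.getLastD 0 < c := by
    rcases List.mem_cons.1 (getLastD_mem_cons X₁ 0) with h | h
    · omega
    · exact (hX₁ _ h).2
  have hlm : a < X₂.getLastD m := by
    rcases List.mem_cons.1 (getLastD_mem_cons X₂ m) with h | h
    · omega
    · exact (hX₂ _ h).1
  have hha : X₂.headD a < c := by
    rcases List.mem_cons.1 (headD_mem_cons X₂ a) with h | h
    · omega
    · exact (hX₂ _ h).2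
  have hh₂ : X₂.headD 0 < c := by
    rcases List.mem_cons.1 (headD_mem_cons X₂ 0) with h | h
    · omega
    · exact (hX₂ _ h).2
  have e213 : count213 (X₁ ++ (M ++ (X₂ ++ [a, c]))) 0
      = X₁.length + X₂.length + count213 (X₁ ++ c :: X₂) 0 + count213 M 0 := by
    have t₁ : (X₁.map fun x => ups x (M ++ (X₂ ++ [a, c])) 0).sum
        = X₁.length + (X₁.map fun x => ups x (c :: X₂) 0).sum := by
      rw [← sum_map_eq_length (X := X₁) (f := fun _ => 1) fun _ _ => rfl, ← List.sum_map_add]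
      refine congrArg _ (List.map_congr_left fun x hx => ?_)
      have hx' := hX₁ x hx
      rw [ups_append, ups_append, ups_eq_zero_of_le _ fun y hy => (hx'.2.trans (hM y hy)).le,
        ups_cons_of_lt hx'.1 (by simp) (by simpa using hx'.2), ups, if_neg (by omega),
        ups_congr (b' := 0) X₂ (by simp only [List.headD_cons]; omega)]
      ring
    have t₂ : (M.map fun x => ups x (X₂ ++ [a, c]) 0).sum = 0 :=
      sum_map_eq_zero fun x hx => ups_eq_zero_of_ge (Nat.zero_le _) fun y hy => by
        have := hM x hx
        simp only [List.mem_append, List.mem_cons, List.not_mem_nil, or_false] at hy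
        rcases hy with hy | rfl | rfl
        · have := hX₂ y hy; omega
        · omega
        · omega
    have t₃ : (X₂.map fun x => ups x [a, c] 0).sum = X₂.length :=
      sum_map_eq_length fun x hx =>
        ups_cons_of_lt (hX₂ x hx).1 (by simp) (by simpa using (hX₂ x hx).2)
    rw [count213_append, count213_append, count213_append, count213_append, t₁, t₂, t₃,
      count213_congr (b' := c) (l := X₁) fun x hx => by have := hX₁ x hx; omega,
      count213_congr (b' := 0) (l := M) fun x hx => by
        have := hM x hx
        rw [headD_append]
        simp only [List.headD_cons]
        omega,
      count213_congr (b' := 0) (l := X₂) fun x hx => by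
        have := hX₂ x hx
        simp only [List.headD_cons]
        omega]
    simp only [count213, ups, List.headD_cons, List.headD_nil,
      ups_eq_zero_of_ge (b := 0) (Nat.zero_le _) fun y hy => (hX₂ y hy).2.le]
    simp
    ring
  have e312 : count312 0 (X₁ ++ (M ++ (X₂ ++ [a, c])))
      = count312 0 (X₁ ++ c :: X₂) + count312 0 M + 1 := by
    have t₁ : ((M ++ (X₂ ++ [a, c])).map fun y => downs y 0 X₁).sum
        = ((c :: X₂).map fun y => downs y 0 X₁).sum := by
      simp only [List.map_append, List.sum_append, List.map_cons, List.sum_cons, List.map_nil,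
        List.sum_nil]
      rw [sum_map_eq_zero (X := M) fun y hy => downs_eq_zero_of_ge (Nat.zero_le _) fun x hx => by
          have := hX₁ x hx; have := hM y hy; omega,
        downs_eq_zero_of_le fun x hx => (hX₁ x hx).1.le]
      ring
    have t₂ : ((X₂ ++ [a, c]).map fun y => downs y (X₁.getLastD 0) M).sum = 0 :=
      sum_map_eq_zero fun y hy => downs_eq_zero_of_le fun x hx => by
        have := hM x hx
        simp only [List.mem_append, List.mem_cons, List.not_mem_nil, or_false] at hy
        rcases hy with hy | rfl | rfl
        · have := hX₂ y hy; omega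
        · omega
        · omega
    have t₄ : downs c m (X₂ ++ [a]) = 1 :=
      downs_of_lt hlast (by simp) fun x hx => by
        simp only [List.mem_append, List.mem_singleton] at hx
        rcases hx with hx | rfl
        · exact (hX₂ x hx).2
        · exact hac
    have t₅ : downs a m X₂ = 0 := downs_eq_zero_of_le fun x hx => (hX₂ x hx).1.le
    rw [count312_append, count312_append, t₁, t₂, ← hm,
      show X₂ ++ [a, c] = (X₂ ++ [a]) ++ [c] by simp, count312_append, count312_append,
      count312_append, count312_congr (a' := 0) (l := M) fun x hx => by have := hM x hx; omega,
      count312_congr (a' := c) (l := X₂) fun x hx => by have := hX₂ x hx; omega,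
      count312.eq_2 _ c X₂, List.countP_eq_zero.2]
    · simp only [List.map_cons, List.map_nil, List.sum_cons, List.sum_nil, t₄, t₅, count312,
        List.countP_nil]
      ring
    · intro y hy
      have := hX₂ y hy
      simp only [decide_eq_true_eq]
      omega
  have echain : chainWt u v w 0 (X₁ ++ (M ++ (X₂ ++ [a, c]))) 0
      = w * (chainWt u v w 0 (X₁ ++ c :: X₂) 0 * chainWt u v w 0 M 0) := by
    rw [chainWt_append, chainWt_append, chainWt_append, chainWt_append, ← hm,
      chainWt_congr_right u v w 0 (b' := c) (l := X₁) fun x hx => by have := hX₁ x hx; omega,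
      chainWt_congr_left u v w (a' := 0) (l := M) _ fun x hx => by have := hM x hx; omega,
      chainWt_congr_right u v w 0 (b' := 0) (l := M) fun x hx => by
        have := hM x hx
        rw [headD_append]
        simp only [List.headD_cons]
        omega,
      chainWt_congr_left u v w (a' := c) (l := X₂) _ fun x hx => by have := hX₂ x hx; omega,
      chainWt_congr_right u v w c (b' := 0) (l := X₂) fun x hx => by
        have := hX₂ x hx
        simp only [List.headD_cons]
        omega,
      chainWt, chainWt, chainWt, chainWt, localWt_valley _ _ _ hlm (by simpa),
      localWt_peak u v w (x := c) (b := ([] : List ℕ).headD 0) hac (by simp; omega),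
      localWt_peak u v w (x := c) hl₁ hh₂]
    simp only [List.headD_cons]
    ring
  rw [listWt, listWt, listWt, e213, e312, echain, hC]
  simp only [Nat.zero_add, pow_add, pow_zero, pow_one]
  ring

end Weights

/-! ### The recursion for sums over good words -/

section Recursion

/-- The words in which each of the letters `a, …, a + n - 1` occurs exactly once. -/
def words (a n : ℕ) : Finset (List ℕ) := (List.range' a n).permutations.toFinset

theorem mem_words {a n : ℕ} {l : List ℕ} :
    l ∈ words a n ↔ l.Nodup ∧ ∀ x, x ∈ l ↔ a ≤ x ∧ x < a + n := by
  rw [words, List.mem_toFinset, List.mem_permutations]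
  constructor
  · intro h
    refine ⟨h.nodup_iff.2 List.nodup_range', fun x => ?_⟩
    rw [h.mem_iff, List.mem_range'_1]
  · rintro ⟨h₁, h₂⟩
    rw [List.perm_ext_iff_of_nodup h₁ List.nodup_range']
    intro x
    rw [h₂, List.mem_range'_1]

theorem length_of_mem_words {a n : ℕ} {l : List ℕ} (h : l ∈ words a n) : l.length = n := by
  rw [words, List.mem_toFinset, List.mem_permutations] at h
  simpa using h.length_eq

theorem ne_nil_of_mem_words {a n : ℕ} {l : List ℕ} (h : l ∈ words a (n + 1)) : l ≠ [] := by
  rintro rfl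
  simpa using length_of_mem_words h

open Classical in
/-- The good words. -/
noncomputable def goodWords (a n : ℕ) : Finset (List ℕ) :=
  (words a n).filter fun l => Good [] l []

/-- The words that avoid `312`. -/
def words312 (a n : ℕ) : Finset (List ℕ) := (words a n).filter fun l => count312 0 l = 0

theorem mem_goodWords {a n : ℕ} {l : List ℕ} :
    l ∈ goodWords a n ↔ l ∈ words a n ∧ Good [] l [] := by
  simp [goodWords]

theorem mem_words312 {a n : ℕ} {l : List ℕ} :
    l ∈ words312 a n ↔ l ∈ words a n ∧ Avoid312 [] l [] := by
  rw [words312, Finset.mem_filter]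
  exact and_congr_right fun h => (avoid312_iff_count312 (mem_words.1 h).1).symm

theorem cons_mem_words {a n : ℕ} {l : List ℕ} :
    a :: l ∈ words a (n + 1) ↔ l ∈ words (a + 1) n := by
  simp only [mem_words, List.nodup_cons, List.mem_cons]
  constructor
  · rintro ⟨⟨h₁, h₂⟩, h₃⟩
    refine ⟨h₂, fun x => ?_⟩
    have := h₃ x
    by_cases hx : x = a
    · subst hx
      simp [h₁]
    · simp only [hx, false_or] at this
      rw [this]
      omega
  · rintro ⟨h₁, h₂⟩
    refine ⟨⟨fun h => by rw [h₂] at h; omega, h₁⟩, fun x => ?_⟩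
    rw [h₂]
    omega

theorem append_cons_mem_words {a n : ℕ} {X Y : List ℕ} :
    X ++ a :: Y ∈ words a (n + 1) ↔ X ++ Y ∈ words (a + 1) n := by
  rw [← cons_mem_words, mem_words, mem_words, List.nodup_middle]
  simp only [List.mem_append, List.mem_cons]
  refine and_congr_right fun _ => forall_congr' fun x => ?_
  rw [or_left_comm]

/-- A word on an interval of letters that splits into smaller and larger letters. -/
theorem append_mem_words {a n : ℕ} {X Y : List ℕ} (h : X ++ Y ∈ words a n)
    (hXY : ∀ x ∈ X, ∀ y ∈ Y, x < y) :
    X ∈ words a X.length ∧ Y ∈ words (a + X.length) Y.length := by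
  rw [words, List.mem_toFinset, List.mem_permutations] at h
  have hn : n = X.length + Y.length := by simpa using h.length_eq.symm
  -- Once each part is sorted, the concatenation is a sorted rearrangement of the interval, hence
  -- the interval itself; cutting by length identifies the two parts.
  have hs : X.mergeSort ++ Y.mergeSort = List.range' a n := by
    refine List.Perm.eq_of_pairwise (le := (· ≤ ·)) (fun x y _ _ => le_antisymm) ?_ ?_
      (((List.mergeSort_perm _ _).append (List.mergeSort_perm _ _)).trans h)
    · rw [List.pairwise_append]
      refine ⟨List.pairwise_mergeSort' _ _, List.pairwise_mergeSort' _ _, fun x hx y hy => ?_⟩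
      rw [List.mem_mergeSort] at hx hy
      exact (hXY x hx y hy).le
    · exact (List.pairwise_lt_range').imp le_of_lt
  rw [hn, ← List.range'_append_1] at hs
  obtain ⟨hs₁, hs₂⟩ := List.append_inj hs (by simp)
  simp only [words, List.mem_toFinset, List.mem_permutations]
  rw [← hs₁, ← hs₂]
  exact ⟨(List.mergeSort_perm _ _).symm, (List.mergeSort_perm _ _).symm⟩

theorem append_mem_words_of_mem {a k m : ℕ} {X Y : List ℕ} (hX : X ∈ words a k)
    (hY : Y ∈ words (a + k) m) : X ++ Y ∈ words a (k + m) := by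
  rw [mem_words] at *
  refine ⟨List.nodup_append'.2 ⟨hX.1, hY.1, fun x hx hy => ?_⟩, fun x => ?_⟩
  · rw [hX.2] at hx
    rw [hY.2] at hy
    omega
  · rw [List.mem_append, hX.2, hY.2]
    omega

theorem lt_of_mem_words {a b n : ℕ} {l : List ℕ} (h : l ∈ words b n) (hab : a < b) :
    ∀ x ∈ l, a < x := fun x hx => by
  have := ((mem_words.1 h).2 x).1 hx
  omega

/-- Replace the letter `c` by the word `M`. -/
def substLetter (c : ℕ) (M X : List ℕ) : List ℕ := X.flatMap fun x => if x = c then M else [x]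

theorem substLetter_eq_self {c : ℕ} {M X : List ℕ} (h : c ∉ X) : substLetter c M X = X := by
  induction X with
  | nil => rfl
  | cons x X ih =>
    simp only [List.mem_cons, not_or] at h
    rw [substLetter, List.flatMap_cons, if_neg (Ne.symm h.1), ← substLetter, ih h.2]
    rfl

theorem substLetter_append_cons {c : ℕ} {M X₁ X₂ : List ℕ} (h₁ : c ∉ X₁) (h₂ : c ∉ X₂) :
    substLetter c M (X₁ ++ c :: X₂) = X₁ ++ (M ++ X₂) := by
  rw [substLetter, List.flatMap_append, List.flatMap_cons, if_pos rfl, ← substLetter,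
    ← substLetter, substLetter_eq_self h₁, substLetter_eq_self h₂]

theorem exists_split_max {a k : ℕ} {X : List ℕ} (h : X ∈ words (a + 1) (k + 1)) :
    ∃ X₁ X₂, X = X₁ ++ (a + 1 + k) :: X₂ ∧ (∀ x ∈ X₁, a < x ∧ x < a + 1 + k) ∧
      (∀ x ∈ X₂, a < x ∧ x < a + 1 + k) ∧ X₁.length + X₂.length = k := by
  have hl := length_of_mem_words h
  rw [mem_words] at h
  obtain ⟨X₁, X₂, rfl⟩ := List.append_of_mem ((h.2 (a + 1 + k)).2 (by omega))
  obtain ⟨h₁, h₂⟩ := h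
  rw [List.nodup_middle, List.nodup_cons, List.mem_append, not_or] at h₁
  have key : ∀ x, x ∈ X₁ ∨ x ∈ X₂ → a < x ∧ x < a + 1 + k := fun x hx => by
    have h₃ := (h₂ x).1 (by simp only [List.mem_append, List.mem_cons]; tauto)
    have : x ≠ a + 1 + k := by rintro rfl; tauto
    omega
  refine ⟨X₁, X₂, rfl, fun x hx => key x (Or.inl hx), fun x hx => key x (Or.inr hx), ?_⟩
  simp only [List.length_append, List.length_cons] at hl
  omega

theorem append_cons_inj {a : ℕ} {X Y X' Y' : List ℕ} (h : a ∉ X) (h' : a ∉ X')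
    (e : X ++ a :: Y = X' ++ a :: Y') : X = X' ∧ Y = Y' := by
  induction X generalizing X' with
  | nil =>
    cases X' with
    | nil => simpa using e
    | cons x X' =>
      simp only [List.nil_append, List.cons_append, List.cons.injEq] at e
      simp [e.1] at h'
  | cons x X ih =>
    cases X' with
    | nil =>
      simp only [List.nil_append, List.cons_append, List.cons.injEq] at e
      simp [e.1] at h
    | cons x' X' =>
      simp only [List.cons_append, List.cons.injEq] at e
      simp only [List.mem_cons, not_or] at h h'
      obtain ⟨rfl, rfl⟩ := ih h.2 h'.2 e.2
      simp [e.1]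

/-- Pairs of a word avoiding `312` and a good word on the larger letters. -/
noncomputable def wordPairs (a n : ℕ) : Finset (Σ _ : ℕ, List ℕ × List ℕ) :=
  (Finset.range n).sigma fun i => words312 (a + 1) (i + 1) ×ˢ goodWords (a + 1 + (i + 1)) (n - i)

theorem mem_wordPairs {a n i : ℕ} {X Y : List ℕ} :
    ⟨i, X, Y⟩ ∈ wordPairs a n ↔
      i < n ∧ X ∈ words312 (a + 1) (i + 1) ∧ Y ∈ goodWords (a + 1 + (i + 1)) (n - i) := by
  simp [wordPairs]

/-- The four shapes of a word `X a Y`. -/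
inductive HasShape (a : ℕ) (l : List ℕ) : Fin 4 → Prop
  | first (Y) (h : l = [] ++ a :: Y) : HasShape a l 0
  | last (X) (h : l = X ++ a :: []) (ha : a ∉ X) (hX : X ≠ []) : HasShape a l 1
  | lt (X Y) (h : l = X ++ a :: Y) (ha : a ∉ X) (hX : X ≠ []) (hY : Y ≠ [])
      (hlt : ∀ x ∈ X, ∀ y ∈ Y, x < y) : HasShape a l 2
  | block (X Y) (h : l = X ++ a :: Y) (ha : a ∉ X) (hX : X ≠ []) (hY : Y ≠ [])
      (hlt : ¬ ∀ x ∈ X, ∀ y ∈ Y, x < y) : HasShape a l 3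

/-- Cutting at the first `a` determines `X` and `Y`, and the conditions on them exclude one another.
-/
theorem HasShape.unique {a : ℕ} {l : List ℕ} {i j : Fin 4} (hi : HasShape a l i)
    (hj : HasShape a l j) : i = j := by
  cases hi <;> cases hj <;> first
    | rfl
    | (exfalso
       subst_vars
       rename_i e
       obtain ⟨rfl, rfl⟩ := append_cons_inj (by simp_all) (by simp_all) e
       simp_all)

/-- The word with least letter `a` built from a pair of words, the smaller letters of the first
one being on both sides of the second one, except for the largest of them, which is put at the
end. -/
def blockWord (a : ℕ) (x : Σ _ : ℕ, List ℕ × List ℕ) : List ℕ :=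
  substLetter (a + 1 + x.1) x.2.2 x.2.1 ++ [a, a + 1 + x.1]

theorem blockWord_eq {a i : ℕ} {X₁ X₂ M : List ℕ} (h₁ : ∀ x ∈ X₁, a < x ∧ x < a + 1 + i)
    (h₂ : ∀ x ∈ X₂, a < x ∧ x < a + 1 + i) :
    blockWord a ⟨i, X₁ ++ (a + 1 + i) :: X₂, M⟩
      = X₁ ++ (M ++ (X₂ ++ [a, a + 1 + i])) := by
  simp only [blockWord]
  rw [substLetter_append_cons (fun h => by have := h₁ _ h; omega)
    (fun h => by have := h₂ _ h; omega)]
  simp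

/-- The good words of the given shape. -/
noncomputable def shapePart (a n : ℕ) : Fin 4 → Finset (List ℕ) :=
  ![(goodWords (a + 1) (n + 1)).image (a :: ·), (goodWords (a + 1) (n + 1)).image (· ++ [a]),
    (wordPairs a n).image fun x => x.2.1 ++ a :: x.2.2, (wordPairs a n).image (blockWord a)]

theorem exists_blocks_of_mem_wordPairs {a n i : ℕ} {X M : List ℕ}
    (h : ⟨i, X, M⟩ ∈ wordPairs a n) :
    ∃ X₁ X₂, X = X₁ ++ (a + 1 + i) :: X₂ ∧ (∀ x ∈ X₁, a < x ∧ x < a + 1 + i) ∧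
      (∀ x ∈ X₂, a < x ∧ x < a + 1 + i) ∧ X₁.length + X₂.length = i ∧
      (∀ x ∈ M, a + 1 + i < x) ∧ M ≠ [] ∧
      blockWord a ⟨i, X, M⟩ = X₁ ++ (M ++ (X₂ ++ [a, a + 1 + i])) := by
  rw [mem_wordPairs, mem_words312, mem_goodWords] at h
  obtain ⟨hi, ⟨hX, -⟩, hM, -⟩ := h
  obtain ⟨X₁, X₂, rfl, h₁, h₂, h₃⟩ := exists_split_max hX
  refine ⟨X₁, X₂, rfl, h₁, h₂, h₃, lt_of_mem_words hM (by omega), ?_, blockWord_eq h₁ h₂⟩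
  rintro rfl
  have := length_of_mem_words hM
  simp only [List.length_nil] at this
  omega

theorem lt_of_mem_wordPairs {a n i : ℕ} {X M : List ℕ} (h : ⟨i, X, M⟩ ∈ wordPairs a n) :
    (∀ x ∈ X, a < x) ∧ (∀ x ∈ M, a < x) ∧ X ≠ [] ∧ M ≠ [] ∧ ∀ x ∈ X, ∀ y ∈ M, x < y := by
  have h₀ := exists_blocks_of_mem_wordPairs h
  rw [mem_wordPairs, mem_words312, mem_goodWords] at h
  obtain ⟨hi, ⟨hX, -⟩, hM, -⟩ := h
  refine ⟨lt_of_mem_words hX (by omega), lt_of_mem_words hM (by omega),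
    ne_nil_of_mem_words hX, ?_, fun x hx y hy => ?_⟩
  · obtain ⟨_, _, _, _, _, _, _, h, _⟩ := h₀
    exact h
  · have h₁ := ((mem_words.1 hX).2 x).1 hx
    have h₂ := ((mem_words.1 hM).2 y).1 hy
    omega

theorem hasShape_of_mem_shapePart {a n : ℕ} {i : Fin 4} {l : List ℕ} (h : l ∈ shapePart a n i) :
    HasShape a l i := by
  fin_cases i
  · obtain ⟨Y, hY, rfl⟩ := Finset.mem_image.1 h
    exact .first Y rfl
  · obtain ⟨X, hX, rfl⟩ := Finset.mem_image.1 h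
    rw [mem_goodWords] at hX
    exact .last X rfl (fun h => (lt_of_mem_words hX.1 (Nat.lt_succ_self a) a h).false)
      (ne_nil_of_mem_words hX.1)
  · obtain ⟨⟨i, X, Y⟩, hx, rfl⟩ := Finset.mem_image.1 h
    obtain ⟨h₁, h₂, h₃, h₄, h₅⟩ := lt_of_mem_wordPairs hx
    exact .lt X Y rfl (fun h => (h₁ a h).false) h₃ h₄ h₅
  · obtain ⟨⟨i, X, M⟩, hx, rfl⟩ := Finset.mem_image.1 h
    obtain ⟨X₁, X₂, rfl, h₁, h₂, -, h₄, h₅, h₆⟩ := exists_blocks_of_mem_wordPairs hx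
    obtain ⟨m, hm⟩ := List.exists_mem_of_ne_nil M h₅
    have hm' := h₄ m hm
    refine .block (X₁ ++ (M ++ X₂)) [a + 1 + i] (by rw [h₆]; simp) ?_ (by simp [h₅]) (by simp) ?_
    · simp only [List.mem_append]
      rintro (h | h | h)
      · have := h₁ a h; omega
      · have := h₄ a h; omega
      · have := h₂ a h; omega
    · intro h
      have := h m (by simp [hm]) (a + 1 + i) (by simp)
      omega

theorem shapePart_subset {a n : ℕ} (i : Fin 4) : shapePart a n i ⊆ goodWords a (n + 2) := by
  intro l h
  rw [mem_goodWords]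
  fin_cases i
  · obtain ⟨Y, hY, rfl⟩ := Finset.mem_image.1 h
    rw [mem_goodWords] at hY
    exact ⟨cons_mem_words.2 hY.1, (good_cons_iff (lt_of_mem_words hY.1 (by omega))).2 hY.2⟩
  · obtain ⟨X, hX, rfl⟩ := Finset.mem_image.1 h
    rw [mem_goodWords] at hX
    exact ⟨append_cons_mem_words.2 (by simpa using hX.1),
      (good_concat_iff (lt_of_mem_words hX.1 (by omega))).2 hX.2⟩
  · obtain ⟨⟨i, X, Y⟩, hx, rfl⟩ := Finset.mem_image.1 h
    obtain ⟨h₁, h₂, h₃, h₄, h₅⟩ := lt_of_mem_wordPairs hx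
    rw [mem_wordPairs, mem_words312, mem_goodWords] at hx
    obtain ⟨hi, hX, hY⟩ := hx
    refine ⟨append_cons_mem_words.2 ?_, (good_append_cons_iff h₁ h₂ h₅ h₄).2 ⟨hX.2, hY.2⟩⟩
    have := append_mem_words_of_mem hX.1 hY.1
    rwa [show i + 1 + (n - i) = n + 1 by omega] at this
  · obtain ⟨⟨i, X, M⟩, hx, rfl⟩ := Finset.mem_image.1 h
    obtain ⟨X₁, X₂, rfl, h₁, h₂, -, h₄, h₅, h₆⟩ := exists_blocks_of_mem_wordPairs hx
    rw [mem_wordPairs, mem_words312, mem_goodWords] at hx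
    obtain ⟨hi, hX, hM⟩ := hx
    rw [h₆]
    refine ⟨?_, (good_blocks_iff h₁ h₂ h₄ h₅ (by omega)).2 ⟨hX.2, hM.2⟩⟩
    rw [show X₁ ++ (M ++ (X₂ ++ [a, a + 1 + i])) = (X₁ ++ M ++ X₂) ++ a :: [a + 1 + i] by simp]
    refine append_cons_mem_words.2 ?_
    have := append_mem_words_of_mem hX.1 hM.1
    rw [show i + 1 + (n - i) = n + 1 by omega] at this
    have hp : ((X₁ ++ (a + 1 + i) :: X₂) ++ M).Perm (X₁ ++ M ++ X₂ ++ [a + 1 + i]) := by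
      rw [← Multiset.coe_eq_coe]
      simp only [← Multiset.coe_add, ← Multiset.cons_coe, Multiset.coe_nil]
      simp only [← Multiset.singleton_add]
      abel_nf
    rw [words, List.mem_toFinset, List.mem_permutations] at this ⊢
    exact hp.symm.trans this

theorem exists_mem_shapePart {a n : ℕ} {l : List ℕ} (h : l ∈ goodWords a (n + 2)) :
    ∃ i, l ∈ shapePart a n i := by
  rw [mem_goodWords] at h
  obtain ⟨hw, hg⟩ := h
  obtain ⟨X, Y, rfl⟩ := List.append_of_mem (((mem_words.1 hw).2 a).2 (by omega))
  have hn := (mem_words.1 hw).1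
  have hw' := append_cons_mem_words.1 hw
  have hgt := lt_of_mem_words hw' (Nat.lt_succ_self a)
  have hX : ∀ x ∈ X, a < x := fun x hx => hgt x (by simp [hx])
  have hY : ∀ x ∈ Y, a < x := fun x hx => hgt x (by simp [hx])
  by_cases hX0 : X = []
  · subst hX0
    exact ⟨0, Finset.mem_image.2 ⟨Y, mem_goodWords.2 ⟨hw', (good_cons_iff hY).1 hg⟩, rfl⟩⟩
  by_cases hY0 : Y = []
  · subst hY0
    exact ⟨1, Finset.mem_image.2 ⟨X, mem_goodWords.2 ⟨by simpa using hw',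
      (good_concat_iff hX).1 hg⟩, rfl⟩⟩
  have hX1 := List.length_pos_iff.2 hX0
  have hY1 := List.length_pos_iff.2 hY0
  by_cases hXY : ∀ x ∈ X, ∀ y ∈ Y, x < y
  · have hl : X.length + Y.length = n + 1 := by simpa using length_of_mem_words hw'
    obtain ⟨h₁, h₂⟩ := append_mem_words hw' hXY
    obtain ⟨h₃, h₄⟩ := (good_append_cons_iff hX hY hXY hY0).1 hg
    refine ⟨2, Finset.mem_image.2 ⟨⟨X.length - 1, X, Y⟩, ?_, rfl⟩⟩
    rw [mem_wordPairs, mem_words312, mem_goodWords, Nat.sub_add_cancel hX1,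
      show n - (X.length - 1) = Y.length by omega]
    exact ⟨by omega, ⟨h₁, h₃⟩, h₂, h₄⟩
  · obtain ⟨c, X₁, M, X₂, rfl, rfl, hM0, hM, hX₁, hX₂⟩ := exists_blocks_of_good hn hX hY hXY hg
    have hac := hY c (by simp)
    have hX₁' : ∀ x ∈ X₁, a < x ∧ x < c := fun x hx => ⟨hX x (by simp [hx]), hX₁ x hx⟩
    have hX₂' : ∀ x ∈ X₂, a < x ∧ x < c := fun x hx => ⟨hX x (by simp [hx]), hX₂ x hx⟩
    have hp : (X₁ ++ (M ++ X₂) ++ [c]).Perm ((X₁ ++ c :: X₂) ++ M) := by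
      rw [← Multiset.coe_eq_coe]
      simp only [← Multiset.coe_add, ← Multiset.cons_coe, Multiset.coe_nil]
      simp only [← Multiset.singleton_add]
      abel_nf
    have hw'' : (X₁ ++ c :: X₂) ++ M ∈ words (a + 1) (n + 1) := by
      rw [words, List.mem_toFinset, List.mem_permutations] at hw' ⊢
      exact hp.symm.trans hw'
    have hl := length_of_mem_words hw''
    obtain ⟨h₁, h₂⟩ := append_mem_words hw'' fun x hx y hy => by
      have := hM y hy
      rcases List.mem_append.1 hx with hx | hx
      · have := hX₁ x hx; omega
      · rcases List.mem_cons.1 hx with rfl | hx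
        · exact this
        · have := hX₂ x hx; omega
    have hM1 := List.length_pos_iff.2 hM0
    simp only [List.length_append, List.length_cons] at hl h₁ h₂
    rw [← add_assoc (List.length _)] at h₁ h₂
    -- `c` is the largest letter of `X₁ c X₂`, whose letters fill an interval starting at `a + 1`.
    have hc : c = a + 1 + (X₁.length + X₂.length) := by
      obtain ⟨Z₁, Z₂, e, g₁, g₂, -⟩ := exists_split_max h₁
      have := ((mem_words.1 h₁).2 c).1 (by simp)
      have : a + 1 + (X₁.length + X₂.length) ∈ X₁ ++ c :: X₂ := e ▸ by simp
      simp only [List.mem_append, List.mem_cons] at this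
      rcases this with h | h | h
      · have := hX₁ _ h; omega
      · exact h.symm
      · have := hX₂ _ h; omega
    subst hc
    rw [show X₁ ++ (M ++ X₂) ++ a :: [a + 1 + (X₁.length + X₂.length)]
      = X₁ ++ (M ++ (X₂ ++ [a, a + 1 + (X₁.length + X₂.length)])) by simp] at hg ⊢
    obtain ⟨h₃, h₄⟩ := (good_blocks_iff hX₁' hX₂' hM hM0 hac).1 hg
    refine ⟨3, Finset.mem_image.2 ⟨⟨X₁.length + X₂.length,
      X₁ ++ (a + 1 + (X₁.length + X₂.length)) :: X₂, M⟩, ?_, blockWord_eq hX₁' hX₂'⟩⟩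
    rw [mem_wordPairs, mem_words312, mem_goodWords,
      show n - (X₁.length + X₂.length) = M.length by omega]
    exact ⟨by omega, ⟨h₁, h₃⟩, h₂, h₄⟩

theorem goodWords_eq_biUnion (a n : ℕ) :
    goodWords a (n + 2) = Finset.univ.biUnion (shapePart a n) := by
  ext l
  rw [Finset.mem_biUnion]
  exact ⟨fun h => (exists_mem_shapePart h).imp fun i hi => ⟨Finset.mem_univ _, hi⟩,
    fun ⟨i, _, hi⟩ => shapePart_subset i hi⟩

theorem append_cons_injOn (a n : ℕ) :
    Set.InjOn (fun x : Σ _ : ℕ, List ℕ × List ℕ => x.2.1 ++ a :: x.2.2) (wordPairs a n) := by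
  rintro ⟨i, X, Y⟩ hx ⟨j, X', Y'⟩ hx' e
  have h₁ := (lt_of_mem_wordPairs hx).1
  have h₂ := (lt_of_mem_wordPairs hx').1
  obtain ⟨rfl, rfl⟩ := append_cons_inj (fun h => (h₁ a h).false) (fun h => (h₂ a h).false) e
  have hi := length_of_mem_words (mem_words312.1 (mem_wordPairs.1 hx).2.1).1
  have hj := length_of_mem_words (mem_words312.1 (mem_wordPairs.1 hx').2.1).1
  obtain rfl : i = j := by omega
  rfl

/-- The last letter recovers `c`, hence `i`; `X₁` is the longest prefix below `c`; and `M` is the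
next factor of length `n - i`. -/
theorem blockWord_injOn (a n : ℕ) : Set.InjOn (blockWord a) (wordPairs a n) := by
  rintro ⟨i, X, M⟩ hx ⟨j, X', M'⟩ hx' e
  obtain rfl : i = j := by
    have := congrArg (fun l => l.getLast?) e
    simp [blockWord] at this
    omega
  obtain ⟨X₁, X₂, rfl, h₁, h₂, -, h₄, h₅, h₆⟩ := exists_blocks_of_mem_wordPairs hx
  obtain ⟨Z₁, Z₂, rfl, g₁, g₂, -, g₄, g₅, g₆⟩ := exists_blocks_of_mem_wordPairs hx'
  have hM := length_of_mem_words (mem_goodWords.1 (mem_wordPairs.1 hx).2.2).1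
  have hM' := length_of_mem_words (mem_goodWords.1 (mem_wordPairs.1 hx').2.2).1
  rw [h₆, g₆] at e
  have key : ∀ {U V W : List ℕ}, (∀ x ∈ U, a < x ∧ x < a + 1 + i) → (∀ x ∈ V, a + 1 + i < x) →
      V ≠ [] → (U ++ (V ++ W)).takeWhile (· < a + 1 + i) = U := by
    intro U V W hU hV hV0
    rw [List.takeWhile_append_of_pos (by simpa using fun x hx => (hU x hx).2)]
    cases V with
    | nil => exact absurd rfl hV0
    | cons v V =>
      have := hV v (by simp)
      rw [List.cons_append, List.takeWhile_cons_of_neg (by simp; omega), List.append_nil]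
  have e₁ : X₁ = Z₁ := by
    rw [← key h₁ h₄ h₅, e, key g₁ g₄ g₅]
  subst e₁
  obtain ⟨rfl, e₂⟩ := List.append_inj (List.append_cancel_left e) (hM.trans hM'.symm)
  rw [List.append_cancel_right e₂]

variable {R : Type*} [CommRing R]

/-- The sum of the weights of the good words. -/
noncomputable def goodSum (p q u v w : R) (a n : ℕ) : R := ∑ l ∈ goodWords a n, listWt p q u v w l

/-- Since `0 ^ 0 = 1`, the value `q = 0` keeps just the words without 31-2. These avoid 312, and
such words are automatically good. -/
theorem goodSum_zero_right (p u v w : R) (a n : ℕ) :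
    goodSum p 0 u v w a n = ∑ l ∈ words312 a n, listWt p 0 u v w l := by
  refine (Finset.sum_subset (fun l hl => ?_) fun l hl hl' => ?_).symm
  · rw [mem_words312] at hl
    exact mem_goodWords.2 ⟨hl.1, good_of_avoid312 hl.2⟩
  · rw [mem_goodWords] at hl
    rw [words312, Finset.mem_filter, not_and] at hl'
    rw [listWt, zero_pow (hl' hl.1), mul_zero, zero_mul]

theorem sum_wordPairs (p q u v w : R) (a n : ℕ) :
    ∑ x ∈ wordPairs a n, p ^ x.1 * (listWt p 0 u v w x.2.1 * listWt p q u v w x.2.2)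
      = ∑ i ∈ Finset.range n, p ^ i * (goodSum p 0 u v w (a + 1) (i + 1)
        * goodSum p q u v w (a + 1 + (i + 1)) (n - i)) := by
  rw [wordPairs, Finset.sum_sigma]
  refine Finset.sum_congr rfl fun i _ => ?_
  rw [goodSum_zero_right, goodSum, Finset.sum_mul_sum, Finset.sum_product]
  simp only [Finset.mul_sum]

/-- The four shapes contribute the factors `u`, `v`, `w p` and `w q`; the last two multiply the same
sum over `wordPairs`, whence `p + q`. -/
theorem goodSum_add_two (p q u v w : R) {a : ℕ} (ha : 0 < a) (n : ℕ) :
    goodSum p q u v w a (n + 2) = (u + v) * goodSum p q u v w (a + 1) (n + 1)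
      + w * (p + q) * ∑ i ∈ Finset.range n, p ^ i * (goodSum p 0 u v w (a + 1) (i + 1)
        * goodSum p q u v w (a + 1 + (i + 1)) (n - i)) := by
  have hd : Set.PairwiseDisjoint ((Finset.univ : Finset (Fin 4)) : Set (Fin 4))
      (shapePart a n) := fun i _ j _ hij => Finset.disjoint_left.2 fun l hi hj =>
    hij ((hasShape_of_mem_shapePart hi).unique (hasShape_of_mem_shapePart hj))
  have e₀ : ∑ l ∈ shapePart a n 0, listWt p q u v w l = u * goodSum p q u v w (a + 1) (n + 1) := by
    rw [goodSum, Finset.mul_sum]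
    refine (Finset.sum_image fun _ _ _ _ h => List.tail_eq_of_cons_eq h).trans
      (Finset.sum_congr rfl fun l hl => ?_)
    rw [mem_goodWords] at hl
    exact listWt_cons p q u v w ha (lt_of_mem_words hl.1 (by omega)) (ne_nil_of_mem_words hl.1)
  have e₁ : ∑ l ∈ shapePart a n 1, listWt p q u v w l = v * goodSum p q u v w (a + 1) (n + 1) := by
    rw [goodSum, Finset.mul_sum]
    refine (Finset.sum_image fun _ _ _ _ h => List.append_cancel_right h).trans
      (Finset.sum_congr rfl fun l hl => ?_)
    rw [mem_goodWords] at hl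
    exact listWt_concat p q u v w ha (lt_of_mem_words hl.1 (by omega))
      (ne_nil_of_mem_words hl.1)
  have e₂ : ∑ l ∈ shapePart a n 2, listWt p q u v w l
      = w * p * ∑ x ∈ wordPairs a n,
        p ^ x.1 * (listWt p 0 u v w x.2.1 * listWt p q u v w x.2.2) := by
    rw [Finset.mul_sum]
    refine (Finset.sum_image (append_cons_injOn a n)).trans (Finset.sum_congr rfl ?_)
    rintro ⟨i, X, Y⟩ hx
    obtain ⟨h₁, h₂, h₃, h₄, h₅⟩ := lt_of_mem_wordPairs hx
    have hX := mem_words312.1 (mem_wordPairs.1 hx).2.1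
    rw [listWt_append_cons p q u v w ha h₁ h₂ h₃ h₄ h₅
      (count312_eq_zero_of_avoid312 (Or.inl rfl) hX.2), length_of_mem_words hX.1]
    ring
  have e₃ : ∑ l ∈ shapePart a n 3, listWt p q u v w l
      = w * q * ∑ x ∈ wordPairs a n,
        p ^ x.1 * (listWt p 0 u v w x.2.1 * listWt p q u v w x.2.2) := by
    rw [Finset.mul_sum]
    refine (Finset.sum_image (blockWord_injOn a n)).trans (Finset.sum_congr rfl ?_)
    rintro ⟨i, X, M⟩ hx
    have hX := mem_words312.1 (mem_wordPairs.1 hx).2.1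
    obtain ⟨X₁, X₂, rfl, h₁, h₂, h₃, h₄, h₅, h₆⟩ := exists_blocks_of_mem_wordPairs hx
    rw [h₆, listWt_blocks p q u v w ha h₁ h₂ h₄ h₅ (by omega)
      (count312_eq_zero_of_avoid312 (Or.inl rfl) hX.2), h₃]
    ring
  rw [goodSum, goodWords_eq_biUnion, Finset.sum_biUnion hd, Fin.sum_univ_four, e₀, e₁, e₂, e₃,
    sum_wordPairs]
  ring

theorem goodSum_one (p q u v w : R) {a : ℕ} (ha : 0 < a) : goodSum p q u v w a 1 = 1 := by
  have : goodWords a 1 = {[a]} := by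
    ext l
    simp [goodWords, words]
    rintro rfl
    simp [Good]
  rw [goodSum, this, Finset.sum_singleton, listWt, chainWt, localWt_peak u v w ha (by simpa)]
  simp [count213, count312, ups, chainWt]

end Recursion

/-! ### The continued fraction and the `γ`-expansion -/

section Algebra

variable {R : Type*} [CommRing R]

/-- The recursion and its initial value do not depend on the least letter, so no relabelling of
words is needed. The induction varies `q` because the recursion also uses `q = 0`. -/
theorem goodSum_eq_base (p q u v w : R) {a : ℕ} (ha : 0 < a) (n : ℕ) :
    goodSum p q u v w a (n + 1) = goodSum p q u v w 1 (n + 1) := by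
  induction n using Nat.strong_induction_on generalizing a q with
  | _ n ih =>
    cases n with
    | zero => rw [goodSum_one _ _ _ _ _ ha, goodSum_one _ _ _ _ _ one_pos]
    | succ n =>
      rw [goodSum_add_two _ _ _ _ _ ha, goodSum_add_two _ _ _ _ _ one_pos,
        ih n (by omega) q (a := a + 1) (by omega), ih n (by omega) q (a := 1 + 1) (by omega)]
      congr 2
      refine Finset.sum_congr rfl fun i hi => ?_
      rw [Finset.mem_range] at hi
      rw [show n - i = (n - 1 - i) + 1 by omega, ih i (by omega) 0 (a := a + 1) (by omega),
        ih i (by omega) 0 (a := 1 + 1) (by omega),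
        ih _ (by omega) q (a := a + 1 + (i + 1)) (by omega),
        ih _ (by omega) q (a := 1 + 1 + (i + 1)) (by omega)]

/-- The sum of the weights of the good words of length `n + 1`. -/
noncomputable def goodSeq (p q u v w : R) (n : ℕ) : R := goodSum p q u v w 1 (n + 1)

theorem goodSeq_zero (p q u v w : R) : goodSeq p q u v w 0 = 1 := goodSum_one _ _ _ _ _ one_pos

theorem goodSeq_succ (p q u v w : R) (n : ℕ) :
    goodSeq p q u v w (n + 1) = (u + v) * goodSeq p q u v w n + w * (p + q) *
      ∑ i ∈ Finset.range n, p ^ i * (goodSeq p 0 u v w i * goodSeq p q u v w (n - 1 - i)) := by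
  rw [goodSeq, goodSum_add_two _ _ _ _ _ one_pos, goodSum_eq_base _ _ _ _ _ (by omega), goodSeq]
  congr 2
  refine Finset.sum_congr rfl fun i hi => ?_
  rw [Finset.mem_range] at hi
  rw [show n - i = (n - 1 - i) + 1 by omega, goodSum_eq_base _ _ _ _ _ (a := 1 + 1) (by omega),
    goodSum_eq_base _ _ _ _ _ (a := 1 + 1 + (i + 1)) (by omega), goodSeq, goodSeq]

open PowerSeries in
theorem mk_goodSeq_mul (p q u v w : R) :
    PowerSeries.mk (goodSeq p q u v w) * (1 - C (u + v) * X
      - C (w * (p + q)) * X ^ 2 * rescale p (PowerSeries.mk (goodSeq p 0 u v w))) = 1 := by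
  have h : PowerSeries.mk (goodSeq p q u v w)
      = 1 + X * (C (u + v) * PowerSeries.mk (goodSeq p q u v w) + X * (C (w * (p + q)) * (rescale p (PowerSeries.mk (goodSeq p 0 u v w))
        * PowerSeries.mk (goodSeq p q u v w)))) := by
    ext n
    rcases n with _ | _ | n
    · simp [goodSeq_zero]
    · rw [map_add, coeff_succ_X_mul, map_add, coeff_zero_X_mul, coeff_C_mul, coeff_mk, coeff_mk,
        goodSeq_succ]
      simp [coeff_one]
    · rw [map_add, coeff_succ_X_mul, map_add, coeff_succ_X_mul, coeff_C_mul, coeff_C_mul, coeff_mk,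
        coeff_mk, goodSeq_succ, coeff_mul, Finset.Nat.sum_antidiagonal_eq_sum_range_succ_mk]
      simp [coeff_one, mul_assoc]
  linear_combination h

open PowerSeries in
-- The error at level `h` is the error at level `h + 1` times a multiple of `X ^ 2`, so each level
-- gains at least one correct coefficient.
theorem X_pow_dvd_jConvergent_sub_of_tails {b lam : ℕ → R} {f : ℕ → PowerSeries R}
    (hf : ∀ h, f h * (1 - C (b h) * X - C (lam h) * X ^ 2 * f (h + 1)) = 1) (m h : ℕ) :
    X ^ m ∣ jConvergent b lam m h - f h := by
  induction m generalizing h with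
  | zero => simp
  | succ m ih =>
    obtain ⟨c, hc⟩ := ih (h + 1)
    have h₁ := jConvergent_succ_mul b lam m h
    refine ⟨C (lam h) * X * c * jConvergent b lam (m + 1) h * f h, ?_⟩
    linear_combination f h * h₁ - jConvergent b lam (m + 1) h * hf h
      + C (lam h) * X ^ 2 * jConvergent b lam (m + 1) h * f h * hc

open PowerSeries in
/-- A J-fraction is determined by its tails. -/
theorem jFraction_eq_of_tails {b lam : ℕ → R} {f : ℕ → PowerSeries R}
    (hf : ∀ h, f h * (1 - C (b h) * X - C (lam h) * X ^ 2 * f (h + 1)) = 1) :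
    jFraction b lam = f 0 := by
  ext n
  rw [jFraction, coeff_mk, ← sub_eq_zero, ← map_sub]
  exact X_pow_dvd_iff.1 (X_pow_dvd_jConvergent_sub_of_tails hf (n + 1) 0) n (Nat.lt_succ_self n)

open PowerSeries in
theorem catB_eq_goodSeq (p q t : R) (n : ℕ) : catB p q t n = goodSeq p q 1 t t n := by
  set Φ : R → PowerSeries R := fun q => PowerSeries.mk (goodSeq p q 1 t t)
  -- The tail at level `h ≥ 1` is `Φ 0` at `p ^ h z`. Rescaling turns the coefficient `p t` of `z²`
  -- in its equation into `p ^ (2 * h + 1) * t`; only the top level involves `q`.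
  have key : ∀ h, (if h = 0 then Φ q else rescale (p ^ h) (Φ 0)) * (1 - C (p ^ h * (1 + t)) * X
      - C (if h = 0 then (p + q) * t else p ^ (2 * h + 1) * t) * X ^ 2
        * (if h + 1 = 0 then Φ q else rescale (p ^ (h + 1)) (Φ 0))) = 1 := by
    intro h
    rcases h with _ | h
    · simpa [mul_comm t] using mk_goodSeq_mul p q 1 t t
    · have hC : ∀ a r : R, rescale a (C r) = C r := fun a r => by
        ext n
        rw [coeff_rescale, coeff_C]
        split_ifs with hn <;> simp [hn]
      have := congrArg (rescale (p ^ (h + 1))) (mk_goodSeq_mul p 0 1 t t)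
      simp only [map_mul, map_sub, map_one, map_pow, rescale_X, rescale_rescale, hC] at this
      rw [if_neg (by omega), if_neg (by omega), if_neg (by omega), pow_succ' p (h + 1)]
      refine Eq.trans ?_ this
      simp only [Φ, map_mul, map_add, map_one, map_pow, map_zero]
      ring
  rw [catB, jFraction_eq_of_tails key, if_pos rfl, coeff_mk]

/-! ### Homogeneity of the recursion. -/

section Span

variable {A : Type*} [CommRing A] [Algebra R A]

variable (R) in
/-- The span of the monomials `τ ^ k * β ^ m` with `2 * k + m = n`. -/
def weightSpan (β τ : A) (n : ℕ) : Submodule R A :=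
  Submodule.span R {x | ∃ k m, 2 * k + m = n ∧ x = τ ^ k * β ^ m}

theorem mul_mem_weightSpan {β τ x y : A} {m n : ℕ} (hx : x ∈ weightSpan R β τ m)
    (hy : y ∈ weightSpan R β τ n) : x * y ∈ weightSpan R β τ (m + n) := by
  have := Submodule.mul_mem_mul hx hy
  rw [weightSpan, weightSpan, Submodule.span_mul_span] at this
  refine Submodule.span_mono ?_ this
  rintro _ ⟨_, ⟨k, i, rfl, rfl⟩, _, ⟨l, j, rfl, rfl⟩, rfl⟩
  exact ⟨k + l, i + j, by ring, by simp only [pow_add]; ring⟩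

theorem monomial_mem_weightSpan (β τ : A) {k m n : ℕ} (h : 2 * k + m = n) :
    τ ^ k * β ^ m ∈ weightSpan R β τ n :=
  Submodule.subset_span ⟨k, m, h, rfl⟩

/-- With `β` of degree 1 and `τ` of degree 2, every term of the recursion has degree `n + 1`. The
bound `n < N` on `G` allows `G = F` within a strong induction, as the case `q = 0` requires. -/
theorem mem_weightSpan_of_recursion {β τ : A} {p c : R} {F G : ℕ → A} (h0 : F 0 = 1)
    (hF : ∀ n, F (n + 1) = β * F n
      + τ * (c • ∑ i ∈ Finset.range n, p ^ i • (G i * F (n - 1 - i))))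
    {N : ℕ} (hG : ∀ n < N, G n ∈ weightSpan R β τ n) {n : ℕ} (hn : n ≤ N) :
    F n ∈ weightSpan R β τ n := by
  induction n using Nat.strong_induction_on with
  | _ n ih =>
    cases n with
    | zero => rw [h0]; simpa using monomial_mem_weightSpan (R := R) β τ (k := 0) (m := 0) rfl
    | succ n =>
      rw [hF]
      refine add_mem ?_ ?_
      · have hβ : β ∈ weightSpan R β τ 1 := by
          simpa using monomial_mem_weightSpan (R := R) β τ (k := 0) (m := 1) rfl
        rw [add_comm n]
        exact mul_mem_weightSpan hβ (ih n (by omega) (by omega))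
      · rcases n with _ | n
        · simp
        have hτ : τ ∈ weightSpan R β τ 2 := by
          simpa using monomial_mem_weightSpan (R := R) β τ (k := 1) (m := 0) rfl
        rw [show n + 1 + 1 = 2 + n by ring]
        refine mul_mem_weightSpan hτ (Submodule.smul_mem _ _ (Submodule.sum_mem _ fun i hi =>
          Submodule.smul_mem _ _ ?_))
        rw [Finset.mem_range] at hi
        have := mul_mem_weightSpan (hG i (by omega))
          (ih (n + 1 - 1 - i) (by omega) (by omega))
        rwa [show i + (n + 1 - 1 - i) = n by omega] at this

end Span

open Polynomial in
-- Both coordinates of `x` are the same combination of monomials, evaluated at `(1, X)` and at `(β,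
-- τ)`. The first coordinate loses no information, as `k` determines the exponent `n - 2 * k` of
-- `β`, so it supplies the coefficients for the second.
theorem eq_sum_coeff_of_mem_weightSpan {β τ : R} {n : ℕ} {x : R[X] × R}
    (hx : x ∈ weightSpan R ((1, β) : R[X] × R) (X, τ) n) :
    x.2 = ∑ k ∈ Finset.range (n / 2 + 1), x.1.coeff k * τ ^ k * β ^ (n - 2 * k) := by
  induction hx using Submodule.span_induction with
  | mem x hx =>
    obtain ⟨k, m, rfl, rfl⟩ := hx
    simp only [Prod.pow_mk, Prod.mk_mul_mk, one_pow, mul_one, coeff_X_pow]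
    rw [Finset.sum_eq_single k]
    · simp
    · intro j _ hj
      simp [hj]
    · intro hk
      exact absurd (Finset.mem_range.2 (by omega)) hk
  | zero => simp
  | add x y _ _ hx hy =>
    simp only [Prod.snd_add, Prod.fst_add, coeff_add, hx, hy, add_mul, Finset.sum_add_distrib]
  | smul r x _ hx =>
    simp only [Prod.smul_snd, Prod.smul_fst, coeff_smul, smul_eq_mul, hx, Finset.mul_sum, mul_assoc]

open Polynomial in
theorem goodSeq_eq_sum (p q u v w : R) (n : ℕ) :
    goodSeq p q u v w n = ∑ k ∈ Finset.range (n / 2 + 1),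
      (goodSeq (C p) (C q) 1 0 X n).coeff k * w ^ k * (u + v) ^ (n - 2 * k) := by
  set F : R → ℕ → R[X] × R := fun q n => (goodSeq (C p) (C q) 1 0 X n, goodSeq p q u v w n)
  have hF : ∀ q n, F q (n + 1) = (1, u + v) * F q n
      + (X, w) * ((p + q) • ∑ i ∈ Finset.range n, p ^ i • (F 0 i * F q (n - 1 - i))) := by
    intro q n
    ext1
    · simp only [F, goodSeq_succ (C p), map_zero, Prod.fst_add, Prod.fst_mul, Prod.smul_fst,
        Prod.fst_sum, smul_eq_C_mul, C_add, C_pow]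
      ring
    · simp only [F, goodSeq_succ p, Prod.snd_add, Prod.snd_mul, Prod.smul_snd, Prod.snd_sum,
        smul_eq_mul]
      ring
  have h0 : ∀ q, F q 0 = 1 := fun q => by simp only [F, goodSeq_zero]; rfl
  have hG : ∀ n, F 0 n ∈ weightSpan R ((1, u + v) : R[X] × R) (X, w) n := fun n => by
    induction n using Nat.strong_induction_on with
    | _ n ih => exact mem_weightSpan_of_recursion (h0 0) (hF 0) ih le_rfl
  exact eq_sum_coeff_of_mem_weightSpan
    (mem_weightSpan_of_recursion (h0 q) (hF q) (N := n) (fun n _ => hG n) le_rfl)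

theorem goodSeq_valley_zero (p q u v : R) (n : ℕ) : goodSeq p q u v 0 n = (u + v) ^ n := by
  induction n with
  | zero => rw [goodSeq_zero, pow_zero]
  | succ n ih => rw [goodSeq_succ, ih, zero_mul, zero_mul, add_zero, pow_succ']

end Algebra

/-! ### Permutations as words -/

section Permutations

theorem headD_map_range' (f : ℕ → ℕ) (s n : ℕ) :
    ((List.range' s n).map f).headD (f (s + n)) = f s := by
  cases n <;> simp [List.range'_succ]

theorem card_filter_Ico_eq_add (P : ℕ → Prop) [DecidablePred P] {s t : ℕ} (h : s < t) :
    ((Finset.Ico s t).filter P).card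
      = (if P s then 1 else 0) + ((Finset.Ico (s + 1) t).filter P).card := by
  rw [← Finset.insert_Ico_add_one_left_eq_Ico h, Finset.filter_insert]
  split_ifs with hs
  · rw [Finset.card_insert_of_notMem (by simp), add_comm]
  · rw [zero_add]

theorem ups_map_range' (f : ℕ → ℕ) (x s n : ℕ) :
    ups x ((List.range' s n).map f) (f (s + n))
      = ((Finset.Ico s (s + n)).filter fun j => f j < x ∧ x < f (j + 1)).card := by
  induction n generalizing s with
  | zero => simp [ups]
  | succ n ih =>
    rw [List.range'_succ, List.map_cons, ups, card_filter_Ico_eq_add _ (by omega),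
      show s + (n + 1) = s + 1 + n by omega, ih, headD_map_range']

theorem count213_map_range' (f : ℕ → ℕ) (s n : ℕ) :
    count213 ((List.range' s n).map f) (f (s + n)) = ∑ i ∈ Finset.Ico s (s + n),
      ((Finset.Ioo i (s + n)).filter fun j => f j < f i ∧ f i < f (j + 1)).card := by
  induction n generalizing s with
  | zero => simp [count213]
  | succ n ih =>
    rw [List.range'_succ, List.map_cons, count213, Finset.sum_eq_sum_Ico_succ_bot (by omega),
      show s + (n + 1) = s + 1 + n by omega, ih, ups_map_range']
    rfl

theorem countP_map_range' (f : ℕ → ℕ) (P : ℕ → Prop) [DecidablePred P] (s n : ℕ) :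
    ((List.range' s n).map f).countP (fun y => P y)
      = ((Finset.Ico s (s + n)).filter fun i => P (f i)).card := by
  induction n generalizing s with
  | zero => simp
  | succ n ih =>
    rw [List.range'_succ, List.map_cons, List.countP_cons, ih,
      card_filter_Ico_eq_add (s := s) (t := s + (n + 1)) _ (by omega),
      show s + (n + 1) = s + 1 + n by omega, add_comm]
    simp

theorem count312_map_range' (f : ℕ → ℕ) (s n : ℕ) :
    count312 (f s) ((List.range' (s + 1) n).map f) = ∑ j ∈ Finset.Ioo s (s + 1 + n),
      ((Finset.Ioo j (s + 1 + n)).filter fun i => f j < f i ∧ f i < f (j - 1)).card := by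
  induction n generalizing s with
  | zero =>
    rw [show Finset.Ioo s (s + 1 + 0) = ∅ by ext; simp]
    simp [count312]
  | succ n ih =>
    rw [List.range'_succ, List.map_cons, count312,
      countP_map_range' f (fun y => f (s + 1) < y ∧ y < f s), ih,
      show s + 1 + (n + 1) = s + 1 + 1 + n by omega]
    have : Finset.Ioo s (s + 1 + 1 + n) = insert (s + 1) (Finset.Ioo (s + 1) (s + 1 + 1 + n)) := by
      ext; simp; omega
    rw [this, Finset.sum_insert (by simp)]
    rfl

variable {R : Type*} [CommRing R]

theorem chainWt_map_range' (u v w : R) (f : ℕ → ℕ) (s n : ℕ) :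
    chainWt u v w (f s) ((List.range' (s + 1) n).map f) (f (s + 1 + n))
      = ∏ i ∈ Finset.Ico (s + 1) (s + 1 + n), localWt u v w (f (i - 1)) (f i) (f (i + 1)) := by
  induction n generalizing s with
  | zero => simp [chainWt]
  | succ n ih =>
    rw [List.range'_succ, List.map_cons, chainWt, Finset.prod_eq_prod_Ico_succ_bot (by omega),
      show s + 1 + (n + 1) = s + 1 + 1 + n by omega, ih, headD_map_range']
    rfl

theorem good_map_range' (f : ℕ → ℕ) (k n : ℕ) :
    Good ((List.range' 1 k).map f) ((List.range' (1 + k) n).map f) [] ↔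
      ∀ i j r s, 1 ≤ i → i < j → 1 + k ≤ j → j < r → r < 1 + k + n → j < s → s < 1 + k + n →
        f j < f r → f r < f i → f j < f s → f s = f r := by
  induction n generalizing k with
  | zero =>
    simp only [List.range'_zero, List.map_nil, Good, true_iff]
    intros; omega
  | succ n ih =>
    have e : (List.range' 1 k).map f ++ [f (1 + k)] = (List.range' 1 (k + 1)).map f := by
      rw [List.range'_1_concat, List.map_append]
      rfl
    rw [List.range'_succ, List.map_cons, Good, e, add_assoc 1 k 1, ih]
    simp only [List.append_nil, List.mem_map, List.mem_range'_1, forall_exists_index, and_imp]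
    constructor
    · rintro ⟨h₁, h₂⟩ i j r s hi hij hkj hjr hr hjs hs
      rcases hkj.lt_or_eq with h | rfl
      · exact h₂ i j r s hi hij (by omega) hjr (by omega) hjs (by omega)
      · exact h₁ _ i hi (by omega) rfl _ r (by omega) (by omega) rfl _ s (by omega) (by omega) rfl
    · intro h
      refine ⟨?_, fun i j r s hi hij hkj hjr hr hjs hs =>
        h i j r s hi hij (by omega) hjr (by omega) hjs (by omega)⟩
      rintro _ i hi hik rfl _ r hr hr' rfl _ s hs hs' rfl
      exact h i (1 + k) r s hi hik le_rfl (by omega) (by omega) (by omega) (by omega)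

/-- The word of a permutation as a list. -/
def permWord {N : ℕ} (σ : Equiv.Perm (Fin N)) : List ℕ := (List.range' 1 N).map (word σ)

theorem word_eq_zero {N : ℕ} (σ : Equiv.Perm (Fin N)) {i : ℕ} (h : i = 0 ∨ N < i) :
    word σ i = 0 := dif_neg (by omega)

theorem word_succ {N : ℕ} (σ : Equiv.Perm (Fin N)) (i : Fin N) :
    word σ (i + 1) = σ i + 1 := by
  rw [word, dif_pos ⟨by omega, by omega⟩]
  simp

theorem stat2_13_eq {N : ℕ} (σ : Equiv.Perm (Fin N)) :
    stat2_13 σ = count213 (permWord σ) 0 := by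
  have := count213_map_range' (word σ) 1 N
  rw [word_eq_zero σ (i := 1 + N) (by omega)] at this
  rw [permWord, this, stat2_13, show Finset.Ico 1 (1 + N) = Finset.Icc 1 N by ext; simp; omega]
  refine Finset.sum_congr rfl fun i _ => congrArg _ ?_
  ext j
  simp only [Finset.mem_filter, Finset.mem_Ioo]
  constructor
  · rintro ⟨h₁, h₂⟩
    exact ⟨by omega, h₂⟩
  · rintro ⟨h₁, h₂⟩
    -- The list also offers the pair at position `N`, which ends in the letter 0 and so is no
    -- ascent.
    have : j ≠ N := by
      rintro rfl
      rw [word_eq_zero σ (i := j + 1) (by omega)] at h₂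
      omega
    exact ⟨by omega, h₂⟩

theorem stat31_2_eq {N : ℕ} (σ : Equiv.Perm (Fin N)) :
    stat31_2 σ = count312 0 (permWord σ) := by
  have := count312_map_range' (word σ) 0 N
  rw [word_eq_zero σ (i := 0) (by omega), zero_add] at this
  have e : ∀ i, (Finset.Ioo 1 i).filter (fun j => word σ j < word σ i ∧ word σ i < word σ (j - 1))
      = (Finset.Ioo 0 i).filter fun j => word σ j < word σ i ∧ word σ i < word σ (j - 1) := by
    intro i
    ext j
    simp only [Finset.mem_filter, Finset.mem_Ioo]
    constructor
    · rintro ⟨h₁, h₂⟩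
      exact ⟨by omega, h₂⟩
    · rintro ⟨h₁, h₂⟩
      have : j ≠ 1 := by
        rintro rfl
        rw [Nat.sub_self, word_eq_zero σ (i := 0) (by omega)] at h₂
        omega
      exact ⟨by omega, h₂⟩
  simp only [permWord, this, stat31_2, e, Finset.card_filter]
  -- `stat31_2` sums over the letter 2 first, `count312` over the descent 31.
  refine Finset.sum_comm' fun i j => ?_
  simp only [Finset.mem_Icc, Finset.mem_Ioo]
  omega

theorem chainWt_permWord (u v w : R) {N : ℕ} (σ : Equiv.Perm (Fin N)) :
    chainWt u v w 0 (permWord σ) 0 = u ^ da σ * v ^ dd σ * w ^ val σ := by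
  have := chainWt_map_range' u v w (word σ) 0 N
  rw [word_eq_zero σ (i := 0) (by omega), zero_add, word_eq_zero σ (i := 1 + N) (by omega)] at this
  rw [permWord, this, show Finset.Ico 1 (1 + N) = Finset.Icc 1 N by ext; simp; omega]
  simp only [localWt, Finset.prod_mul_distrib, Finset.prod_ite, Finset.prod_const, one_pow, mul_one]
  rw [da, dd, val]
  ring

/-- The lower end of a descent is a valley or a double descent. Conversely, both have a descent
before them, as position 1 is preceded by 0 and cannot be either. -/
theorem des_eq {N : ℕ} (σ : Equiv.Perm (Fin N)) : des σ = val σ + dd σ := by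
  have hinj : ∀ i, 1 ≤ i → i < N → word σ i ≠ word σ (i + 1) := fun i h₁ h₂ h => by
    obtain ⟨i, rfl⟩ : ∃ j, i = j + 1 := ⟨i - 1, by omega⟩
    have h₃ := word_succ σ ⟨i, by omega⟩
    have h₄ := word_succ σ ⟨i + 1, by omega⟩
    simp only at h₃ h₄
    have : σ ⟨i, by omega⟩ = σ ⟨i + 1, by omega⟩ := Fin.ext (by omega)
    simpa using σ.injective this
  have hpos : ∀ i, 1 ≤ i → i ≤ N → 0 < word σ i := fun i h₁ h₂ => by
    rw [word, dif_pos ⟨h₁, h₂⟩]; omega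
  have e : val σ + dd σ
      = ((Finset.Icc 1 N).filter fun i => word σ i < word σ (i - 1)).card := by
    rw [val, dd, ← Finset.card_union_of_disjoint]
    · congr 1
      ext i
      simp only [Finset.mem_union, Finset.mem_filter, Finset.mem_Icc]
      constructor
      · rintro (h | h) <;> exact ⟨h.1, h.2.1⟩
      · rintro ⟨h₁, h₂⟩
        have : word σ i ≠ word σ (i + 1) := by
          rcases h₁.2.lt_or_eq with h | rfl
          · exact hinj i h₁.1 h
          · rw [word_eq_zero σ (i := i + 1) (by omega)]
            exact (hpos i h₁.1 le_rfl).ne'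
        rcases this.lt_or_gt with h | h
        · exact Or.inl ⟨h₁, h₂, h⟩
        · exact Or.inr ⟨h₁, h₂, h⟩
    · rw [Finset.disjoint_left]
      intro i h₁ h₂
      have h₃ := (Finset.mem_filter.1 h₁).2.2
      have h₄ := (Finset.mem_filter.1 h₂).2.2
      omega
  rw [e, des]
  refine Finset.card_bij (fun i _ => i + 1) (fun i hi => ?_) (fun _ _ _ _ h => by omega)
    fun i hi => ?_
  · simp only [Finset.mem_filter, Finset.mem_Ico, Finset.mem_Icc] at hi ⊢
    exact ⟨by omega, by simpa using hi.2⟩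
  · simp only [Finset.mem_filter, Finset.mem_Icc] at hi
    have : i ≠ 1 := by
      rintro rfl
      have := hi.2
      rw [Nat.sub_self, word_eq_zero σ (i := 0) (by omega)] at this
      omega
    refine ⟨i - 1, ?_, by omega⟩
    simp only [Finset.mem_filter, Finset.mem_Ico]
    rw [Nat.sub_add_cancel (by omega)]
    exact ⟨by omega, hi.2⟩

theorem listWt_permWord (p q t u v w : R) {N : ℕ} (σ : Equiv.Perm (Fin N)) :
    listWt p q u (t * v) (t * w) (permWord σ)
      = p ^ stat2_13 σ * q ^ stat31_2 σ * t ^ des σ * u ^ da σ * v ^ dd σ * w ^ val σ := by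
  rw [listWt, ← stat2_13_eq, ← stat31_2_eq, chainWt_permWord, des_eq]
  ring

theorem good_permWord_iff {N : ℕ} (σ : Equiv.Perm (Fin N)) :
    Good [] (permWord σ) [] ↔ ∀ i j r s : Fin N, i < j → j < r → j < s →
      σ j < σ r → σ r < σ i → σ j < σ s → s = r := by
  have h := good_map_range' (word σ) 0 N
  simp only [List.range'_zero, List.map_nil, Nat.add_zero] at h
  rw [permWord, h]
  constructor
  · intro h i j r s hij hjr hjs h₁ h₂ h₃
    have := h (i + 1) (j + 1) (r + 1) (s + 1) (by omega) (by omega) (by omega) (by omega) (by omega)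
      (by omega) (by omega)
    simp only [word_succ] at this
    exact σ.injective (Fin.ext (by omega))
  · intro h i j r s hi hij hj hjr hr hjs hs
    have key : ∀ x, 1 ≤ x → x < 1 + N → ∃ y : Fin N, x = y + 1 := fun x h₁ h₂ =>
      ⟨⟨x - 1, by omega⟩, by simp; omega⟩
    obtain ⟨i, rfl⟩ := key i (by omega) (by omega)
    obtain ⟨j, rfl⟩ := key j (by omega) (by omega)
    obtain ⟨r, rfl⟩ := key r (by omega) (by omega)
    obtain ⟨s, rfl⟩ := key s (by omega) (by omega)
    simp only [word_succ]
    intro h₁ h₂ h₃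
    rw [h i j r s (by omega) (by omega) (by omega) (by omega) (by omega) (by omega)]

theorem not_avoids_of_lt {N : ℕ} {σ : Equiv.Perm (Fin N)} {τ : Fin 4 → ℕ} (hτ : τ.Injective)
    {a b c d : Fin N} (hab : a < b) (hbc : b < c) (hcd : c < d)
    (h : ∀ x y, τ x < τ y → σ (![a, b, c, d] x) < σ (![a, b, c, d] y)) : ¬ Avoids σ τ := by
  rw [Avoids, not_not]
  refine ⟨![a, b, c, d], ?_, fun x y => ⟨fun hxy => ?_, h x y⟩⟩
  · rw [Fin.strictMono_iff_lt_succ]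
    intro i
    fin_cases i <;> assumption
  · rcases lt_trichotomy (τ x) (τ y) with h' | h' | h'
    · exact h'
    · rw [hτ h'] at hxy
      exact absurd hxy (lt_irrefl _)
    · exact absurd hxy (h y x h').not_gt

theorem mem_avoiders_iff {N : ℕ} {σ : Equiv.Perm (Fin N)} :
    σ ∈ avoiders N ↔ Good [] (permWord σ) [] := by
  classical
  rw [good_permWord_iff, avoiders, Finset.mem_filter]
  constructor
  · rintro ⟨-, h₁, h₂, h₃, h₄⟩ i j r s hij hjr hjs hjr' hri hjs'
    by_contra hsr
    have hsi : σ s ≠ σ i := fun h => by have := σ.injective h; omega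
    have hrs : σ s ≠ σ r := fun h => hsr (σ.injective h)
    -- The order of the positions `r`, `s` and the place of `σ s` relative to `σ r < σ i` decide the
    -- pattern; two of the eight combinations are contradictory.
    rcases lt_or_gt_of_ne hsr with hp | hp <;> rcases lt_or_gt_of_ne hrs with hr | hr <;>
      rcases lt_or_gt_of_ne hsi with hi | hi
    · refine not_avoids_of_lt (by decide) hij hjs hp ?_ h₂
      intro x y; fin_cases x <;> fin_cases y <;> simp <;> omega
    · omega
    · refine not_avoids_of_lt (by decide) hij hjs hp ?_ h₄
      intro x y; fin_cases x <;> fin_cases y <;> simp <;> omega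
    · refine not_avoids_of_lt (by decide) hij hjs hp ?_ h₃
      intro x y; fin_cases x <;> fin_cases y <;> simp <;> omega
    · refine not_avoids_of_lt (by decide) hij hjr hp ?_ h₄
      intro x y; fin_cases x <;> fin_cases y <;> simp <;> omega
    · omega
    · refine not_avoids_of_lt (by decide) hij hjr hp ?_ h₂
      intro x y; fin_cases x <;> fin_cases y <;> simp <;> omega
    · refine not_avoids_of_lt (by decide) hij hjr hp ?_ h₁
      intro x y; fin_cases x <;> fin_cases y <;> simp <;> omega
  · intro h
    refine ⟨Finset.mem_univ _, ?_, ?_, ?_, ?_⟩ <;> rintro ⟨f, hf, hσ⟩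
    · exact absurd (h (f 0) (f 1) (f 2) (f 3) (hf (by decide)) (hf (by decide)) (hf (by decide))
        ((hσ _ _).2 (by decide)) ((hσ _ _).2 (by decide)) ((hσ _ _).2 (by decide)))
        (hf (by decide)).ne'
    · exact absurd (h (f 0) (f 1) (f 2) (f 3) (hf (by decide)) (hf (by decide)) (hf (by decide))
        ((hσ _ _).2 (by decide)) ((hσ _ _).2 (by decide)) ((hσ _ _).2 (by decide)))
        (hf (by decide)).ne'
    -- The role of `r` falls to the letter 2, which comes last in 3142 and 4132.
    · exact absurd (h (f 0) (f 1) (f 3) (f 2) (hf (by decide)) (hf (by decide)) (hf (by decide))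
        ((hσ _ _).2 (by decide)) ((hσ _ _).2 (by decide)) ((hσ _ _).2 (by decide)))
        (hf (by decide)).ne
    · exact absurd (h (f 0) (f 1) (f 3) (f 2) (hf (by decide)) (hf (by decide)) (hf (by decide))
        ((hσ _ _).2 (by decide)) ((hσ _ _).2 (by decide)) ((hσ _ _).2 (by decide)))
        (hf (by decide)).ne

theorem permWord_mem_words {N : ℕ} (σ : Equiv.Perm (Fin N)) : permWord σ ∈ words 1 N := by
  rw [mem_words, permWord]
  constructor
  · refine List.Nodup.map_on (fun x hx y hy h => ?_) List.nodup_range'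
    rw [List.mem_range'_1] at hx hy
    have h₁ := word_succ σ ⟨x - 1, by omega⟩
    have h₂ := word_succ σ ⟨y - 1, by omega⟩
    simp only [Nat.sub_add_cancel hx.1, Nat.sub_add_cancel hy.1] at h₁ h₂
    have : σ ⟨x - 1, by omega⟩ = σ ⟨y - 1, by omega⟩ := Fin.ext (by omega)
    have := σ.injective this
    simp only [Fin.mk.injEq] at this
    omega
  · intro x
    simp only [List.mem_map, List.mem_range'_1]
    constructor
    · rintro ⟨i, hi, rfl⟩
      rw [word, dif_pos ⟨by omega, by omega⟩]
      omega
    · intro hx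
      refine ⟨σ.symm ⟨x - 1, by omega⟩ + 1, by omega, ?_⟩
      rw [word_succ, Equiv.apply_symm_apply]
      simp only
      omega

theorem permWord_injective (N : ℕ) : Function.Injective (permWord (N := N)) := by
  intro σ τ h
  ext i
  have := List.map_inj_left.1 h (i + 1) (by rw [List.mem_range'_1]; omega)
  rw [word_succ, word_succ] at this
  omega

theorem exists_permWord_eq {N : ℕ} {l : List ℕ} (h : l ∈ words 1 N) :
    ∃ σ : Equiv.Perm (Fin N), permWord σ = l := by
  have hl := length_of_mem_words h
  rw [mem_words] at h
  have hb : ∀ i : Fin N, 1 ≤ l[(i : ℕ)]'(by omega) ∧ l[(i : ℕ)]'(by omega) < 1 + N := fun i =>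
    (h.2 _).1 (List.getElem_mem _)
  set f : Fin N → Fin N := fun i => ⟨l[(i : ℕ)]'(by omega) - 1, by have := hb i; omega⟩ with hf
  have hinj : Function.Injective f := fun i j hij => by
    simp only [hf, Fin.mk.injEq] at hij
    have h₁ := hb i
    have h₂ := hb j
    exact Fin.ext ((h.1.getElem_inj_iff).1 (by omega))
  refine ⟨Equiv.ofBijective f (Finite.injective_iff_bijective.1 hinj), ?_⟩
  refine List.ext_getElem (by simp [permWord, hl]) fun i h₁ h₂ => ?_
  have h₃ := hb ⟨i, by omega⟩
  have h₄ := word_succ (Equiv.ofBijective f (Finite.injective_iff_bijective.1 hinj)) ⟨i, by omega⟩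
  simp only [Equiv.ofBijective_apply, hf] at h₃ h₄
  simp only [permWord, List.getElem_map, List.getElem_range', one_mul]
  rw [add_comm 1 i, h₄]
  omega

theorem sum_avoiders (f : List ℕ → R) (N : ℕ) :
    ∑ σ ∈ avoiders N, f (permWord σ) = ∑ l ∈ goodWords 1 N, f l := by
  refine Finset.sum_bij (fun σ _ => permWord σ)
    (fun σ hσ => mem_goodWords.2 ⟨permWord_mem_words σ, mem_avoiders_iff.1 hσ⟩)
    (fun _ _ _ _ h => permWord_injective N h) (fun l hl => ?_) fun _ _ => rfl
  rw [mem_goodWords] at hl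
  obtain ⟨σ, rfl⟩ := exists_permWord_eq hl.1
  exact ⟨σ, mem_avoiders_iff.2 hl.2, rfl⟩

theorem catBRefined_eq_goodSeq (p q t u v w : R) (n : ℕ) :
    catBRefined p q t u v w n = goodSeq p q u (t * v) (t * w) n := by
  rw [goodSeq, goodSum, ← sum_avoiders, catBRefined]
  exact Finset.sum_congr rfl fun σ _ => (listWt_permWord p q t u v w σ).symm

open Polynomial in
-- At `v = 0` only permutations without double descents survive. For these `des = val`, so marking
-- descents by `X` sorts them by both statistics at once.
theorem gammaB_eq_coeff (p q : R) (n k : ℕ) :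
    gammaB p q (n + 1) k = (goodSeq (C p) (C q) 1 0 X n).coeff k := by
  have := catBRefined_eq_goodSeq (C p) (C q) X 1 0 1 n
  rw [mul_zero, mul_one] at this
  rw [← this, catBRefined, finsetSum_coeff, gammaB, Finset.sum_filter]
  refine Finset.sum_congr rfl fun σ _ => ?_
  rw [one_pow, one_pow, mul_one, mul_one, ← C_pow, ← C_pow, ← C_mul]
  by_cases hd : dd σ = 0
  · rw [des_eq, hd, pow_zero, mul_one, coeff_C_mul, coeff_X_pow]
    simp [eq_comm]
  · rw [if_neg (fun h => hd h.1), zero_pow hd, mul_zero, coeff_zero]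

theorem catBRefined_eq_sum (p q t u v w : R) (n : ℕ) :
    catBRefined p q t u v w n = ∑ k ∈ Finset.range (n / 2 + 1),
      gammaB p q (n + 1) k * (t * w) ^ k * (u + t * v) ^ (n - 2 * k) := by
  simp only [catBRefined_eq_goodSeq, goodSeq_eq_sum p q u, gammaB_eq_coeff]

theorem catB_eq_sum (p q t : R) (n : ℕ) :
    catB p q t n = ∑ k ∈ Finset.range (n / 2 + 1),
      gammaB p q (n + 1) k * t ^ k * (1 + t) ^ (n - 2 * k) := by
  simp only [catB_eq_goodSeq, goodSeq_eq_sum p q 1, gammaB_eq_coeff]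

open Polynomial in
theorem gammaB_C (p q : R) (N k : ℕ) : gammaB (C p) (C q) N k = C (gammaB p q N k) := by
  simp only [gammaB, map_sum, map_mul, map_pow]

theorem gammaB_nonneg {S : Type*} [CommRing S] [LinearOrder S] [IsStrictOrderedRing S] {p q : S}
    (hp : 0 ≤ p) (hq : 0 ≤ q) (N k : ℕ) : 0 ≤ gammaB p q N k :=
  Finset.sum_nonneg fun _ _ => mul_nonneg (pow_nonneg hp _) (pow_nonneg hq _)

open Polynomial in
theorem isGammaPositive_catB {S : Type*} [CommRing S] [LinearOrder S] [IsStrictOrderedRing S]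
    {p q : S} (hp : 0 ≤ p) (hq : 0 ≤ q) (n : ℕ) :
    IsGammaPositive n (catB (C p) (C q) (X : S[X]) n) := by
  have e := catB_eq_sum (C p) (C q) (X : S[X]) n
  simp only [gammaB_C] at e
  refine ⟨fun h => ?_, gammaB p q (n + 1), gammaB_nonneg hp hq (n + 1), e⟩
  -- The polynomial is nonzero because its value at `t = 0`, where valleys and double descents have
  -- weight 0, is 1.
  have h₁ : catB p q 0 n = 1 := by rw [catB_eq_goodSeq, goodSeq_valley_zero, add_zero, one_pow]
  have h₂ := congrArg (eval 0) (e.symm.trans h)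
  simp only [eval_finsetSum, eval_mul, eval_C, eval_pow, eval_X, eval_add, eval_one,
    eval_zero] at h₂
  rw [catB_eq_sum, h₂] at h₁
  exact zero_ne_one h₁

end Permutations

end CatalanB

theorem theorem1p4 (n : ℕ) :
    -- the expansion of the Taylor coefficients of the continued fraction
    (∀ {R : Type*} [CommRing R] (p q t : R),
      CatalanB.catB p q t n =
        ∑ k ∈ Finset.range (n / 2 + 1),
          CatalanB.gammaB p q (n + 1) k * t ^ k * (1 + t) ^ (n - 2 * k)) ∧
    -- the refined expansion
    (∀ {R : Type*} [CommRing R] (p q t u v w : R),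
      CatalanB.catBRefined p q t u v w n =
        ∑ k ∈ Finset.range (n / 2 + 1),
          CatalanB.gammaB p q (n + 1) k * (t * w) ^ k * (u + t * v) ^ (n - 2 * k)) ∧
    -- positivity, as a polynomial in the last variable, for nonnegative `p` and `q`
    (∀ {S : Type*} [CommRing S] [LinearOrder S] [IsStrictOrderedRing S] (p q : S),
      0 ≤ p → 0 ≤ q →
        CatalanB.IsGammaPositive n
          (CatalanB.catB (Polynomial.C p) (Polynomial.C q) (Polynomial.X : Polynomial S) n)) :=
  ⟨fun p q t => CatalanB.catB_eq_sum p q t n,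
    fun p q t u v w => CatalanB.catBRefined_eq_sum p q t u v w n,
    fun _ _ hp hq => CatalanB.isGammaPositive_catB hp hq n⟩
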